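/- Let $G$ be a (real, finite-dimensional) Lie group with Lie algebra $\mathfrak g$, let $\pi:P\to M$ be a smooth principal $G$-bundle over a smooth manifold $M$ (finite-dimensional, without boundary), with $G$ acting on $P$ from the right, and let $\omega$ be a smooth connection form on $P$. For a local gauge, i.e. a smooth section $\sigma:W\to P$ over an open set $W\subseteq M$, let $A=\sigma^*\omega$ be the gauge potential; in local coordinates its field strength is $$F_{\mu\nu}=\partial_\mu A_\nu-\partial_\nu A_\mu+[A_\mu,A_\nu].$$ (For a matrix group and $A=-i\hat{\mathcal A}$ this is $F_{\mu\nu}=-i\hat{\mathcal F}_{\mu\nu}$ with $\hat{\mathcal F}_{\mu\nu}=\partial_\mu\hat{\mathcal A}_\nu-\partial_\nu\hat{\mathcal A}_\mu-i[\hat{\mathcal A}_\mu,\hat{\mathcal A}_\nu]$.) Fix $x_0\in M$ and $p_0\in\pi^{-1}(x_0)$. An element $g\in G$ is called a holonomy of a piecewise $C^1$ loop $c:[0,1]\to M$ based at $x_0$ if there is a continuous, piecewise $C^1$ path $\tilde c:[0,1]\to P$ with $\pi\circ\tilde c=c$, $\tilde c(0)=p_0$, $\omega(\tilde c')=0$ and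 $\tilde c(1)=p_0\cdot g$. **Theorem.** Suppose that the bundle is flat, i.e. $F_{\mu\nu}=0$ in every local gauge and every chart of the atlas of $M$. Let $c_1,c_2$ be piecewise $C^1$ loops based at $x_0$ which are homotopic through continuous loops based at $x_0$. Then each of them has exactly one holonomy (with respect to $p_0$), and the two holonomies coincide: $$\hat{\mathcal U}_{c_1}=\hat{\mathcal U}_{c_2}=:u\in G.$$ Moreover, for $j=1,2$ and every local gauge $\sigma$ over an open set $W$ that contains the image of $c_j$, with $\sigma(x_0)=p_0$, the path-ordered exponential $$\mathcal P\exp\Big[-\oint_{c_j}A\Big]=\mathcal P\exp\Big[\,i\oint_{c_j}\hat{\mathcal A}_\mu\,dx^\mu\Big],$$ that is, the value $U(1)$ of the unique continuous, piecewise $C^1$ solution $U:[0,1]\to G$ of $U'(s)=-A(c_j'(s))\,U(s)$, $U(0)=1$, exists and equals $u$. -/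

import Mathlib

open Set Manifold
open scoped ContDiff RightActions

noncomputable section

namespace FlatBundle

/-! ### Piecewise `C¹` paths -/

section Paths

variable {E : Type*} [NormedAddCommGroup E] [NormedSpace ℝ E]
  {N : Type*} [TopologicalSpace N] [ChartedSpace E N]

/-- `t 0 ≤ t 1 ≤ ⋯ ≤ t n` is a subdivision of the unit interval. -/
structure IsSubdivision (n : ℕ) (t : ℕ → ℝ) : Prop where
  mono : Monotone t
  zero : t 0 = 0
  last : t n = 1

/-- The path `γ` is `C¹` (up to the end points) on each interval `[t i, t (i+1)]`, `i < n`. -/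
def IsC1OnPieces {x y : N} (γ : Path x y) (n : ℕ) (t : ℕ → ℝ) : Prop :=
  ∀ i < n, ContMDiffOn 𝓘(ℝ, ℝ) 𝓘(ℝ, E) 1 γ.extend (Icc (t i) (t (i + 1)))

/-- A piecewise `C¹` path (continuity is part of the type `Path`). -/
def IsPiecewiseC1 {x y : N} (γ : Path x y) : Prop :=
  ∃ (n : ℕ) (t : ℕ → ℝ), IsSubdivision n t ∧ IsC1OnPieces (E := E) γ n t

/-- The velocity `γ'(s)`; it is used only at points where `γ` is differentiable. -/
def velocity {x y : N} (γ : Path x y) (s : ℝ) : TangentSpace 𝓘(ℝ, E) (γ.extend s) :=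
  mfderiv 𝓘(ℝ, ℝ) 𝓘(ℝ, E) γ.extend s (1 : ℝ)

end Paths

/-! ### Lie groups -/

section Groups

variable {EG : Type*} [NormedAddCommGroup EG] [NormedSpace ℝ EG]
  {G : Type*} [TopologicalSpace G] [ChartedSpace EG G] [Group G]

/-- The adjoint action of `g` on the Lie algebra: the derivative at `1` of `h ↦ g h g⁻¹`. -/
def Ad (g : G) (X : GroupLieAlgebra 𝓘(ℝ, EG) G) : GroupLieAlgebra 𝓘(ℝ, EG) G :=
  show EG from mfderiv 𝓘(ℝ, EG) 𝓘(ℝ, EG) (fun h : G => g * h * g⁻¹) 1 X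

/-- `X · g`, the tangent vector at `g` obtained from `X` by right translation. -/
def rightTranslate (X : GroupLieAlgebra 𝓘(ℝ, EG) G) (g : G) : TangentSpace 𝓘(ℝ, EG) g :=
  show EG from mfderiv 𝓘(ℝ, EG) 𝓘(ℝ, EG) (fun h : G => h * g) 1 X

end Groups

variable {EM : Type*} [NormedAddCommGroup EM] [NormedSpace ℝ EM]
  {EG : Type*} [NormedAddCommGroup EG] [NormedSpace ℝ EG]
  {EP : Type*} [NormedAddCommGroup EP] [NormedSpace ℝ EP]
  {M : Type*} [TopologicalSpace M] [ChartedSpace EM M]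
  {G : Type*} [TopologicalSpace G] [ChartedSpace EG G] [Group G]
  {P : Type*} [TopologicalSpace P] [ChartedSpace EP P]

/-! ### Path-ordered exponentials

A one-form `A` on `M` with values in the Lie algebra of `G` corresponds, for a matrix group, to
`-i Â` in terms of the hermitian gauge potential `Â` of the physics literature. -/

variable (G) in
/-- A one-form on `M` with values in the Lie algebra of `G`. -/
abbrev LieAlgebraOneForm (EM EG : Type*) [NormedAddCommGroup EM] [NormedSpace ℝ EM]
    [NormedAddCommGroup EG] [NormedSpace ℝ EG] (M : Type*) [TopologicalSpace M]
    [ChartedSpace EM M] [ChartedSpace EG G] :=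
  (x : M) → TangentSpace 𝓘(ℝ, EM) x →L[ℝ] GroupLieAlgebra 𝓘(ℝ, EG) G

/-- `u` is the path-ordered exponential `𝒫 exp (-∫_c A) = 𝒫 exp (i ∫_c Â)` along `c`: the value at
time `1` of the continuous, piecewise `C¹` solution `U` of `U' = -A(c') U`, `U(0) = 1`
(later times stand on the left). -/
def IsPathOrderedExp (A : LieAlgebraOneForm G EM EG M) {x y : M} (c : Path x y) (u : G) : Prop :=
  ∃ (U : Path (1 : G) u) (n : ℕ) (t : ℕ → ℝ), IsSubdivision n t ∧
    IsC1OnPieces (E := EM) c n t ∧ IsC1OnPieces (E := EG) U n t ∧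
    ∀ i < n, ∀ s ∈ Ioo (t i) (t (i + 1)),
      velocity U s = -rightTranslate (A (c.extend s) (velocity c s)) (U.extend s)

/-! ### Curvature of a gauge potential in a chart -/

/-- The component `A_v` of the one-form `A` in the chart `φ`, for the constant vector `v`, as a
function of the coordinates. -/
def component (A : LieAlgebraOneForm G EM EG M) (φ : OpenPartialHomeomorph M EM) (v : EM)
    (y : EM) : GroupLieAlgebra 𝓘(ℝ, EG) G :=
  A (φ.symm y) (mfderiv 𝓘(ℝ, EM) 𝓘(ℝ, EM) φ.symm y v)

/-- The non-Abelian field strength `F_{vw} = ∂_v A_w - ∂_w A_v + [A_v, A_w]` in the chart `φ`, at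
the point with coordinates `y`. For a matrix group and `A = -i Â` it is `-i F̂_{vw}`, where
`F̂_{vw} = ∂_v Â_w - ∂_w Â_v - i [Â_v, Â_w]`. -/
def fieldStrength (A : LieAlgebraOneForm G EM EG M) (φ : OpenPartialHomeomorph M EM) (y : EM)
    (v w : EM) : GroupLieAlgebra 𝓘(ℝ, EG) G :=
  (show GroupLieAlgebra 𝓘(ℝ, EG) G from
      fderiv ℝ (fun z => (show EG from component A φ w z)) y v) -
    (show GroupLieAlgebra 𝓘(ℝ, EG) G from
      fderiv ℝ (fun z => (show EG from component A φ v z)) y w) +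
    ⁅component A φ v y, component A φ w y⁆

/-! ### Principal bundles and connections -/

variable (EM EG EP) in
/-- `π : P → M` is a smooth principal bundle with structure group `G`, for the given right action
`p <• g` of `G` on `P`: the action is smooth, preserves the fibres, and around every point of the
base there is a smooth local trivialization which is equivariant. -/
structure IsPrincipalBundle (G : Type*) [TopologicalSpace G] [ChartedSpace EG G] [Group G]
    [MulAction Gᵐᵒᵖ P] (π : P → M) : Prop where
  smooth_proj : ContMDiff 𝓘(ℝ, EP) 𝓘(ℝ, EM) ∞ π
  smooth_act : ContMDiff (𝓘(ℝ, EP).prod 𝓘(ℝ, EG)) 𝓘(ℝ, EP) ∞ (fun q : P × G => q.1 <• q.2)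
  proj_act : ∀ (p : P) (g : G), π (p <• g) = π p
  locally_trivial : ∀ x : M, ∃ e : Bundle.Trivialization G π, x ∈ e.baseSet ∧
    ContMDiffOn 𝓘(ℝ, EP) (𝓘(ℝ, EM).prod 𝓘(ℝ, EG)) ∞ e e.source ∧
    ContMDiffOn (𝓘(ℝ, EM).prod 𝓘(ℝ, EG)) 𝓘(ℝ, EP) ∞ e.toOpenPartialHomeomorph.symm e.target ∧
    ∀ p ∈ e.source, ∀ g : G, (e (p <• g)).2 = (e p).2 * g

variable (EG EP G P) in
/-- A (smooth) connection form on the total space `P` of a principal `G`-bundle. -/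
structure ConnectionForm [IsManifold 𝓘(ℝ, EP) ∞ P] [MulAction Gᵐᵒᵖ P] where
  /-- the underlying one-form with values in the Lie algebra -/
  form : LieAlgebraOneForm G EP EG P
  smooth : ContMDiff 𝓘(ℝ, EP).tangent 𝓘(ℝ, EG) ∞
    (fun v : TangentBundle 𝓘(ℝ, EP) P => (show EG from form v.proj v.snd))
  /-- it reproduces the generators of the fundamental vector fields -/
  vertical : ∀ (p : P) (X : GroupLieAlgebra 𝓘(ℝ, EG) G),
    form (p <• (1 : G)) (mfderiv 𝓘(ℝ, EG) 𝓘(ℝ, EP) (fun g : G => p <• g) 1 X) = X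
  /-- it is equivariant -/
  equivariant : ∀ (g : G) (p : P) (v : TangentSpace 𝓘(ℝ, EP) p),
    form (p <• g) (mfderiv 𝓘(ℝ, EP) 𝓘(ℝ, EP) (fun q : P => q <• g) p v) = Ad g⁻¹ (form p v)

variable (EM EP) in
/-- `σ` restricts to a smooth section of `π` over the open set `W`, i.e. a local gauge. -/
structure IsLocalGauge (π : P → M) (W : Set M) (σ : M → P) : Prop where
  isOpen : IsOpen W
  smooth : ContMDiffOn 𝓘(ℝ, EM) 𝓘(ℝ, EP) ∞ σ W
  section_eq : ∀ x ∈ W, π (σ x) = x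

namespace ConnectionForm

variable [IsManifold 𝓘(ℝ, EP) ∞ P] [MulAction Gᵐᵒᵖ P] (conn : ConnectionForm EG EP G P)

/-- The gauge potential `A = σ^* ω` of the connection in the local gauge `σ`. -/
def gaugePotential (σ : M → P) : LieAlgebraOneForm G EM EG M :=
  fun x => (conn.form (σ x)).comp (mfderiv 𝓘(ℝ, EM) 𝓘(ℝ, EP) σ x)

/-- The connection is flat: its field strength vanishes in all local gauges and all charts. -/
def IsFlat (π : P → M) : Prop :=
  ∀ (W : Set M) (σ : M → P), IsLocalGauge EM EP π W σ →
    ∀ φ ∈ atlas EM M, ∀ y ∈ φ.target, φ.symm y ∈ W →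
      ∀ v w : EM, fieldStrength (conn.gaugePotential (EM := EM) σ) φ y v w = 0

/-- The path `γ` in `P` is a horizontal lift of the path `c` in `M`: it is continuous and piecewise
`C¹`, lies over `c`, and its velocity is annihilated by the connection form. -/
def IsHorizontalLift (π : P → M) {x y : M} (c : Path x y) {p q : P} (γ : Path p q) : Prop :=
  (∀ s, π (γ s) = c s) ∧
  ∃ (n : ℕ) (t : ℕ → ℝ), IsSubdivision n t ∧ IsC1OnPieces (E := EP) γ n t ∧
    ∀ i < n, ∀ s ∈ Ioo (t i) (t (i + 1)), conn.form (γ.extend s) (velocity γ s) = 0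

/-- `g` is the holonomy of the loop `c` with respect to the reference point `p₀`: the horizontal
lift of `c` which starts at `p₀` ends at `p₀ · g`. -/
def IsHolonomy (π : P → M) {x₀ : M} (c : Path x₀ x₀) (p₀ : P) (g : G) : Prop :=
  ∃ γ : Path p₀ (p₀ <• g), conn.IsHorizontalLift π c γ

end ConnectionForm

end FlatBundle

end

/-! Flatness makes the horizontal distribution integrable, so horizontal transport becomes path
lifting in a covering space. Locally, a section `σ` with potential `A` is corrected by a map `k`
into `G` with `dk = k A`; then `σ · k⁻¹` is a horizontal section. In a chart of `G` around `1` this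
is a total differential equation `f' = Φ(x, f)`. By the Maurer–Cartan identity `chartField_bracket`,
its integrability defect is the field strength carried by the left-invariant frame, hence zero, and
the Frobenius theorem `exists_hasFDerivAt_of_integrable` applies. The right translates of a
horizontal section over `W` fill `π⁻¹(W)`, and a horizontal curve over `W` stays on one translate
(`eq_smul_of_horizontal`). So, if `P` is retopologized by declaring horizontal sections to be open
sheets (`LeafSpace`), `π` becomes a covering map with discrete fibre `G` (`IsFlat.isCoveringMap`).
For a piecewise `C¹` loop, horizontal lifts are exactly the lifts continuous in this finer topology
(`continuous_leaf`, `isHorizontalLift`). Existence, uniqueness and homotopy invariance of the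
holonomy are therefore those of lifts to a covering. Finally, in a gauge `σ` around the loop, `σ(c)
· U` is horizontal precisely when `U' = -A(c') U`, which identifies holonomies with path-ordered
exponentials. -/

noncomputable section

namespace FlatBundle

/-! ### The Frobenius theorem for total differential equations. -/

section Frobenius

open Metric Filter Topology NNReal

variable {E F : Type*} [NormedAddCommGroup E] [NormedSpace ℝ E]
  [NormedAddCommGroup F] [NormedSpace ℝ F]

/-- A `C²` map is, near each point, bounded with bounded and Lipschitz derivative. -/
theorem _root_.ContDiffAt.exists_closedBall_bounds {Φ : E → F} {z : E} (hΦ : ContDiffAt ℝ 2 Φ z) :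
    ∃ C > 0, ∃ ρ > 0, ∀ p ∈ closedBall z ρ, DifferentiableAt ℝ Φ p ∧ ‖Φ p‖ ≤ C ∧
      ‖fderiv ℝ Φ p‖ ≤ C ∧ ∀ q ∈ closedBall z ρ, ‖fderiv ℝ Φ q - fderiv ℝ Φ p‖ ≤ C * ‖q - p‖ := by
  have h1 : ContDiffAt ℝ 1 (fderiv ℝ Φ) z := hΦ.fderiv_right (by norm_num)
  obtain ⟨K, s, hs, hK⟩ := h1.exists_lipschitzOnWith
  have h2 : ∀ᶠ p in 𝓝 z, ContDiffAt ℝ 2 Φ p := hΦ.eventually (by simp)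
  have h3 : ∀ᶠ p in 𝓝 z, ‖Φ p‖ < ‖Φ z‖ + 1 :=
    hΦ.continuousAt.norm.eventually_lt continuousAt_const (by simp)
  have h4 : ∀ᶠ p in 𝓝 z, ‖fderiv ℝ Φ p‖ < ‖fderiv ℝ Φ z‖ + 1 :=
    h1.continuousAt.norm.eventually_lt continuousAt_const (by simp)
  obtain ⟨ρ, hρ, H⟩ := nhds_basis_closedBall.mem_iff.1 ((h2.and (h3.and h4)).and hs)
  refine ⟨max (max (‖Φ z‖ + 1) (‖fderiv ℝ Φ z‖ + 1)) K, by positivity, ρ, hρ, fun p hp => ?_⟩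
  obtain ⟨⟨h5, h6, h7⟩, h8⟩ := H hp
  refine ⟨h5.differentiableAt (by simp), h6.le.trans (by simp), h7.le.trans (by simp),
    fun q hq => ?_⟩
  refine (hK.norm_sub_le (H hq).2 h8).trans ?_
  gcongr
  simp

/-- The Picard–Lindelöf theorem on the unit interval, with a confined solution. -/
theorem exists_solution_mem_closedBall [CompleteSpace F] {v : ℝ → F → F} {u₀ : F} {R : ℝ}
    (hR : 0 ≤ R) {K : ℝ≥0} (hK : ∀ t ∈ Icc (0 : ℝ) 1, LipschitzOnWith K (v t) (closedBall u₀ R))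
    (hc : ∀ u ∈ closedBall u₀ R, ContinuousOn (v · u) (Icc 0 1))
    (hb : ∀ t ∈ Icc (0 : ℝ) 1, ∀ u ∈ closedBall u₀ R, ‖v t u‖ ≤ R) :
    ∃ α : ℝ → F, α 0 = u₀ ∧ ∀ t ∈ Icc (0 : ℝ) 1, α t ∈ closedBall u₀ R ∧
      HasDerivWithinAt α (v t (α t)) (Icc 0 1) t := by
  lift R to ℝ≥0 using hR
  have h01 : (0 : ℝ) ∈ Icc (0 : ℝ) 1 := by simp
  have hf : IsPicardLindelof v ⟨0, h01⟩ u₀ R 0 R K := ⟨hK, hc, hb, by simp⟩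
  have hx : u₀ ∈ closedBall u₀ ((0 : ℝ≥0) : ℝ) := by simp
  -- The fixed point of the Picard operator is taken itself, because the curves of `FunSpace` stay
  -- in the ball by construction.
  obtain ⟨α, hα⟩ := ODE.FunSpace.exists_isFixedPt_next hf hx
  refine ⟨α.compProj, ?_, fun t ht => ⟨α.compProj_mem_closedBall hf.mul_max_le, ?_⟩⟩
  · have := α.compProj_val (t := ⟨0, h01⟩)
    rw [this, ← hα, ODE.FunSpace.next_apply₀]
  · apply ODE.hasDerivWithinAt_picard_Icc h01 hf.continuousOn_uncurry
      α.continuous_compProj.continuousOn (fun _ ht' ↦ α.compProj_mem_closedBall hf.mul_max_le)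
      u₀ ht |>.congr_of_mem _ ht
    intro t' ht'
    nth_rw 1 [← hα]
    rw [ODE.FunSpace.compProj_of_mem ht', ODE.FunSpace.next_apply]

/-- The **Frobenius theorem** for total differential equations: if `Φ` satisfies the integrability
condition, then the equation `f' = Φ(x, f)` has a local solution with given initial value. -/
theorem exists_hasFDerivAt_of_integrable [CompleteSpace F] {Φ : E × F → E →L[ℝ] F} {x₀ : E} {u₀ : F}
    (hΦ : ContDiffAt ℝ 2 Φ (x₀, u₀))
    (hint : ∀ᶠ p in 𝓝 (x₀, u₀), ∀ v w, fderiv ℝ Φ p (v, Φ p v) w = fderiv ℝ Φ p (w, Φ p w) v) :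
    ∃ f : E → F, f x₀ = u₀ ∧ ∀ᶠ x in 𝓝 x₀, HasFDerivAt f (Φ (x, f x)) x := by
  obtain ⟨C, hC, ρ₁, hρ₁, H₁⟩ := hΦ.exists_closedBall_bounds
  obtain ⟨ρ₂, hρ₂, H₂⟩ := nhds_basis_closedBall.mem_iff.1 hint
  -- `C * r ≤ R` keeps the radial solutions in the ball of radius `R`; the ball of radius `2 * R`
  -- leaves room for the comparison curve `w` below.
  obtain ⟨R, hR, hR1, hR2⟩ : ∃ R > 0, 2 * R ≤ ρ₁ ∧ 2 * R ≤ ρ₂ :=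
    ⟨min ρ₁ ρ₂ / 2, by positivity, by linarith [min_le_left ρ₁ ρ₂],
      by linarith [min_le_right ρ₁ ρ₂]⟩
  obtain ⟨r, hr, hrR, hCr⟩ : ∃ r > 0, r ≤ R ∧ C * r ≤ R :=
    ⟨min R (R / C), by positivity, min_le_left _ _, by
      calc C * min R (R / C) ≤ C * (R / C) := by gcongr; exact min_le_right _ _
        _ = R := by field_simp⟩
  set S : Set (E × F) := closedBall x₀ (2 * R) ×ˢ closedBall u₀ (2 * R) with hS
  have hSconv : Convex ℝ S := (convex_closedBall _ _).prod (convex_closedBall _ _)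
  have hS1 : S ⊆ closedBall (x₀, u₀) ρ₁ := by
    rw [← closedBall_prod_same]
    exact prod_mono (closedBall_subset_closedBall hR1) (closedBall_subset_closedBall hR1)
  have hS2 : S ⊆ closedBall (x₀, u₀) ρ₂ := by
    rw [← closedBall_prod_same]
    exact prod_mono (closedBall_subset_closedBall hR2) (closedBall_subset_closedBall hR2)
  have hdiff : ∀ p ∈ S, DifferentiableAt ℝ Φ p := fun p hp => (H₁ p (hS1 hp)).1
  have hΦC : ∀ p ∈ S, ‖Φ p‖ ≤ C := fun p hp => (H₁ p (hS1 hp)).2.1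
  have hDC : ∀ p ∈ S, ‖fderiv ℝ Φ p‖ ≤ C := fun p hp => (H₁ p (hS1 hp)).2.2.1
  have hLip : ∀ p ∈ S, ∀ q ∈ S, ‖Φ q - Φ p‖ ≤ C * ‖q - p‖ := fun p hp q hq =>
    hSconv.norm_image_sub_le_of_norm_fderiv_le hdiff hDC hp hq
  have hTay : ∀ p ∈ S, ∀ q ∈ S, ‖Φ q - Φ p - fderiv ℝ Φ p (q - p)‖ ≤ C * ‖q - p‖ * ‖q - p‖ := by
    intro p hp q hq
    have hseg : segment ℝ p q ⊆ S := hSconv.segment_subset hp hq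
    refine (convex_segment p q).norm_image_sub_le_of_norm_hasFDerivWithin_le'
      (f' := fderiv ℝ Φ)
      (fun z hz => (hdiff z (hseg hz)).hasFDerivAt.hasFDerivWithinAt) (fun z hz => ?_)
      (left_mem_segment ℝ p q) (right_mem_segment ℝ p q)
    refine ((H₁ p (hS1 hp)).2.2.2 z (hS1 (hseg hz))).trans ?_
    gcongr
    exact norm_sub_le_of_mem_segment hz
  -- the radial equation
  have hmem : ∀ x ∈ ball x₀ r, ∀ t ∈ Icc (0 : ℝ) 1, x₀ + t • (x - x₀) ∈ closedBall x₀ (2 * R) := by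
    intro x hx t ht
    rw [mem_closedBall, dist_eq_norm, add_sub_cancel_left, norm_smul, Real.norm_of_nonneg ht.1]
    have : ‖x - x₀‖ < r := by simpa [dist_eq_norm] using hx
    nlinarith [ht.1, ht.2, norm_nonneg (x - x₀)]
  have hLipv : ∀ x ∈ ball x₀ r, ∀ t ∈ Icc (0 : ℝ) 1,
      LipschitzOnWith (C * r).toNNReal (fun u => Φ (x₀ + t • (x - x₀), u) (x - x₀))
        (closedBall u₀ (2 * R)) := by
    intro x hx t ht
    refine LipschitzOnWith.of_dist_le_mul fun u hu v hv => ?_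
    rw [Real.coe_toNNReal _ (by positivity), dist_eq_norm, ← sub_apply]
    have hx' : ‖x - x₀‖ < r := by simpa [dist_eq_norm] using hx
    have := hLip _ (mk_mem_prod (hmem x hx t ht) hv) _ (mk_mem_prod (hmem x hx t ht) hu)
    rw [Prod.mk_sub_mk, sub_self, Prod.norm_mk, norm_zero, max_eq_right (norm_nonneg _)] at this
    calc _ ≤ ‖Φ (x₀ + t • (x - x₀), u) - Φ (x₀ + t • (x - x₀), v)‖ * ‖x - x₀‖ :=
          ContinuousLinearMap.le_opNorm _ _
      _ ≤ (C * ‖u - v‖) * r := by gcongr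
      _ = C * r * dist u v := by rw [dist_eq_norm]; ring
  have hex : ∀ x ∈ ball x₀ r, ∃ α : ℝ → F, α 0 = u₀ ∧ ∀ t ∈ Icc (0 : ℝ) 1,
      α t ∈ closedBall u₀ R ∧
      HasDerivWithinAt α (Φ (x₀ + t • (x - x₀), α t) (x - x₀)) (Icc 0 1) t := by
    intro x hx
    have hx' : ‖x - x₀‖ < r := by simpa [dist_eq_norm] using hx
    have hsub : closedBall u₀ R ⊆ closedBall u₀ (2 * R) :=
      closedBall_subset_closedBall (by linarith)
    refine exists_solution_mem_closedBall (v := fun t u => Φ (x₀ + t • (x - x₀), u) (x - x₀)) hR.le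
      (fun t ht => (hLipv x hx t ht).mono hsub) (fun u hu => ?_) (fun t ht u hu => ?_)
    · intro t ht
      have h1 := (hdiff _ (mk_mem_prod (hmem x hx t ht) (hsub hu))).continuousAt
      have h2 : ContinuousAt (fun t : ℝ => (x₀ + t • (x - x₀), u)) t := by fun_prop
      exact ((ContinuousAt.comp (f := fun t : ℝ => (x₀ + t • (x - x₀), u)) h1 h2).clm_apply
        continuousAt_const).continuousWithinAt
    · calc _ ≤ ‖Φ (x₀ + t • (x - x₀), u)‖ * ‖x - x₀‖ := ContinuousLinearMap.le_opNorm _ _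
        _ ≤ C * r := by gcongr; exact hΦC _ (mk_mem_prod (hmem x hx t ht) (hsub hu))
        _ ≤ R := hCr
  choose! α hα0 hα using hex
  -- Restricted to the segment from `x₀` to `x`, a solution of the total equation must solve the
  -- radial one, so its value at `x` can only be `α x 1`.
  refine ⟨fun x => α x 1, ?_, ?_⟩
  · have hx : x₀ ∈ ball x₀ r := mem_ball_self hr
    have := constant_of_has_deriv_right_zero (f := α x₀) (a := 0) (b := 1)
      (fun t ht => (hα x₀ hx t ht).2.continuousWithinAt) (fun t ht => by
        have h := (hα x₀ hx t (Ico_subset_Icc_self ht)).2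
        rw [sub_self, map_zero] at h
        exact h.mono_of_mem_nhdsWithin (Icc_mem_nhdsGE_of_mem ht)) 1 (by simp)
    simpa [hα0 x₀ hx] using this
  filter_upwards [ball_mem_nhds x₀ hr] with x hx
  set X := x - x₀ with hX
  have hXr : ‖X‖ < r := by simpa [dist_eq_norm] using hx
  set D := max 1 C with hD
  -- `B * ‖h‖ ^ 2` will bound the defect of `w` in the radial equation towards `x + h`; `B'` is the
  -- Grönwall factor at time `1`, linear in the defect since the initial values agree.
  set B := C * D ^ 2 * (2 * r) + C * D with hB
  set B' := gronwallBound 0 (C * r) 1 1 with hB'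
  have hgr : ∀ ε, gronwallBound 0 (C * r) ε 1 = ε * B' := by
    intro ε
    have : C * r ≠ 0 := by positivity
    simp only [hB', gronwallBound_of_K_ne_0 this]
    ring
  have key : ∀ h : E, x + h ∈ ball x₀ r → ‖h‖ ≤ r →
      ‖α (x + h) 1 - α x 1 - Φ (x, α x 1) h‖ ≤ B * B' * ‖h‖ ^ 2 := by
    intro h hxh hhr
    set p : ℝ → E × F := fun t => (x₀ + t • X, α x t) with hp
    -- The first-order guess for `α (x + h)`: moving the end point by `h` moves the point at time
    -- `t` by `t • h`. At `t = 1` it yields the claimed derivative.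
    set w : ℝ → F := fun t => α x t + t • Φ (p t) h with hw
    have hpS : ∀ t ∈ Icc (0 : ℝ) 1, p t ∈ S := fun t ht =>
      mk_mem_prod (hmem x hx t ht) (closedBall_subset_closedBall (by linarith) (hα x hx t ht).1)
    have hwS : ∀ t ∈ Icc (0 : ℝ) 1, w t ∈ closedBall u₀ (2 * R) := by
      intro t ht
      have h1 : ‖α x t - u₀‖ ≤ R := by simpa [dist_eq_norm] using (hα x hx t ht).1
      have h2 : ‖t • Φ (p t) h‖ ≤ R := by
        rw [norm_smul, Real.norm_of_nonneg ht.1]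
        calc t * ‖Φ (p t) h‖ ≤ 1 * (C * r) := by
              gcongr
              · exact ht.2
              · exact ((Φ (p t)).le_opNorm h).trans (by gcongr; exact hΦC _ (hpS t ht))
          _ ≤ R := by simpa using hCr
      rw [mem_closedBall, dist_eq_norm]
      calc ‖w t - u₀‖ = ‖(α x t - u₀) + t • Φ (p t) h‖ := by simp only [hw]; congr 1; abel
        _ ≤ R + R := norm_add_le_of_le h1 h2
        _ = 2 * R := by ring
    have hw' : ∀ t ∈ Icc (0 : ℝ) 1, HasDerivWithinAt w (Φ (p t) X + (Φ (p t) h +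
        t • fderiv ℝ Φ (p t) (X, Φ (p t) X) h)) (Icc 0 1) t := by
      intro t ht
      have h1 : HasDerivWithinAt p (X, Φ (p t) X) (Icc 0 1) t := by
        have h2 : HasDerivWithinAt (fun t : ℝ => x₀ + t • X) X (Icc 0 1) t := by
          simpa using (((hasDerivAt_id t).smul_const X).const_add x₀).hasDerivWithinAt
        exact h2.prodMk (hα x hx t ht).2
      have h3 : HasDerivWithinAt (fun t => Φ (p t)) (fderiv ℝ Φ (p t) (X, Φ (p t) X)) (Icc 0 1) t :=
        (hdiff _ (hpS t ht)).hasFDerivAt.comp_hasDerivWithinAt t h1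
      have h4 : HasDerivWithinAt (fun t => Φ (p t) h) (fderiv ℝ Φ (p t) (X, Φ (p t) X) h)
          (Icc 0 1) t := by
        simpa using h3.clm_apply (hasDerivWithinAt_const t (Icc 0 1) h)
      have h5 := (hα x hx t ht).2.add ((hasDerivWithinAt_id t (Icc 0 1)).smul h4)
      refine h5.congr_deriv ?_
      simp only [hp, hX, id, one_smul]
      abel
    have hmono : ∀ {g : ℝ → F} {g' : F} {t : ℝ}, t ∈ Ico (0 : ℝ) 1 →
        HasDerivWithinAt g g' (Icc 0 1) t → HasDerivWithinAt g g' (Ici t) t := fun ht hg =>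
      hg.mono_of_mem_nhdsWithin (Icc_mem_nhdsGE_of_mem ht)
    have hXh : x + h - x₀ = X + h := by rw [hX]; abel
    have hbound : ∀ t ∈ Icc (0 : ℝ) 1, ‖(Φ (p t) X + (Φ (p t) h +
        t • fderiv ℝ Φ (p t) (X, Φ (p t) X) h)) - Φ (x₀ + t • (x + h - x₀), w t) (x + h - x₀)‖ ≤
        B * ‖h‖ ^ 2 := by
      intro t ht
      set δ : E × F := (h, Φ (p t) h) with hδ
      have hq : (x₀ + t • (x + h - x₀), w t) = p t + t • δ := by
        simp only [hXh, hp, hw, hδ, Prod.smul_mk, Prod.mk_add_mk, smul_add, add_assoc]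
      have hqS : p t + t • δ ∈ S := by
        rw [← hq]; exact mk_mem_prod (hmem _ hxh t ht) (hwS t ht)
      have hδn : ‖δ‖ ≤ D * ‖h‖ := by
        rw [hδ, Prod.norm_mk]
        refine max_le ?_ ?_
        · exact le_mul_of_one_le_left (norm_nonneg _) (le_max_left _ _)
        · refine ((Φ (p t)).le_opNorm h).trans ?_
          gcongr
          exact (hΦC _ (hpS t ht)).trans (le_max_right _ _)
      -- Integrability replaces the derivative along the ray, applied to `h`, by the derivative
      -- along `δ`, applied to `X`. The latter is the Taylor term of `Φ (p t + t • δ) X`, so only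
      -- quadratic errors remain.
      have hint' := H₂ (hS2 (hpS t ht)) X h
      rw [hint', hq, hXh]
      have hTay' := hTay _ (hpS t ht) _ hqS
      rw [add_sub_cancel_left, map_smul] at hTay'
      have e : Φ (p t) X + (Φ (p t) h + t • (fderiv ℝ Φ (p t)) (h, Φ (p t) h) X) -
          Φ (p t + t • δ) (X + h) =
          -((Φ (p t + t • δ) - Φ (p t) - t • fderiv ℝ Φ (p t) δ) (X + h) +
            t • fderiv ℝ Φ (p t) δ h) := by
        simp only [hδ, map_add, sub_apply, smul_apply]
        abel
      rw [e, norm_neg]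
      have hXh' : ‖X + h‖ ≤ 2 * r := (norm_add_le _ _).trans (by linarith)
      have htδ : ‖t • δ‖ ≤ D * ‖h‖ := by
        rw [norm_smul, Real.norm_of_nonneg ht.1]
        exact (mul_le_of_le_one_left (norm_nonneg _) ht.2).trans hδn
      have b1 : ‖(Φ (p t + t • δ) - Φ (p t) - t • fderiv ℝ Φ (p t) δ) (X + h)‖ ≤
          C * (D * ‖h‖) * (D * ‖h‖) * (2 * r) := by
        refine (ContinuousLinearMap.le_opNorm _ _).trans ?_
        gcongr
        refine hTay'.trans ?_
        gcongr
      have b2 : ‖t • fderiv ℝ Φ (p t) δ h‖ ≤ C * (D * ‖h‖) * ‖h‖ := by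
        rw [norm_smul, Real.norm_of_nonneg ht.1]
        refine (mul_le_of_le_one_left (norm_nonneg _) ht.2).trans ?_
        refine (ContinuousLinearMap.le_opNorm _ _).trans ?_
        gcongr
        refine (ContinuousLinearMap.le_opNorm _ _).trans ?_
        gcongr
        exact hDC _ (hpS t ht)
      calc _ ≤ C * (D * ‖h‖) * (D * ‖h‖) * (2 * r) + C * (D * ‖h‖) * ‖h‖ := norm_add_le_of_le b1 b2
        _ = B * ‖h‖ ^ 2 := by rw [hB]; ring
    have := dist_le_of_approx_trajectories_ODE_of_mem (a := 0) (b := 1) (K := (C * r).toNNReal)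
      (v := fun t u => Φ (x₀ + t • (x + h - x₀), u) (x + h - x₀))
      (s := fun _ => closedBall u₀ (2 * R)) (f := w) (g := α (x + h)) (εf := B * ‖h‖ ^ 2) (εg := 0)
      (δ := 0) (fun t ht => hLipv _ hxh t (Ico_subset_Icc_self ht))
      (fun t ht => (hw' t ht).continuousWithinAt)
      (fun t ht => hmono ht (hw' t (Ico_subset_Icc_self ht)))
      (fun t ht => by rw [dist_eq_norm]; exact hbound t (Ico_subset_Icc_self ht))
      (fun t ht => hwS t (Ico_subset_Icc_self ht))
      (fun t ht => (hα _ hxh t ht).2.continuousWithinAt)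
      (fun t ht => hmono ht (hα _ hxh t (Ico_subset_Icc_self ht)).2)
      (fun t ht => by simp)
      (fun t ht => closedBall_subset_closedBall (by linarith)
        (hα _ hxh t (Ico_subset_Icc_self ht)).1)
      (by simp [hw, hα0 x hx, hα0 _ hxh]) 1 (by simp)
    rw [Real.coe_toNNReal _ (by positivity), sub_zero, add_zero, hgr, dist_comm, dist_eq_norm] at this
    calc _ = ‖α (x + h) 1 - w 1‖ := by
          simp only [hw, hp, hX, one_smul, add_sub_cancel]
          congr 1; abel
      _ ≤ B * ‖h‖ ^ 2 * B' := this
      _ = _ := by ring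
  rw [hasFDerivAt_iff_isLittleO_nhds_zero]
  refine Asymptotics.IsBigO.trans_isLittleO (g := fun h : E => ‖h‖ ^ 2) ?_ ?_
  · refine Asymptotics.IsBigO.of_bound (B * B') ?_
    have e1 : ∀ᶠ h in 𝓝 (0 : E), x + h ∈ ball x₀ r := by
      have : Tendsto (fun h : E => x + h) (𝓝 0) (𝓝 x) := by
        simpa using (show Continuous fun h : E => x + h by fun_prop).tendsto 0
      exact this (isOpen_ball.mem_nhds hx)
    filter_upwards [e1, closedBall_mem_nhds (0 : E) hr] with h h1 h2
    simpa using key h h1 (by simpa using h2)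
  · simpa using Asymptotics.isLittleO_norm_pow_id (E' := E) one_lt_two

end Frobenius

set_option linter.unusedSectionVars false

variable {EM : Type*} [NormedAddCommGroup EM] [NormedSpace ℝ EM]
  {EG : Type*} [NormedAddCommGroup EG] [NormedSpace ℝ EG]
  {EP : Type*} [NormedAddCommGroup EP] [NormedSpace ℝ EP]
  {E : Type*} [NormedAddCommGroup E] [NormedSpace ℝ E]
  {E' : Type*} [NormedAddCommGroup E'] [NormedSpace ℝ E']
  {E'' : Type*} [NormedAddCommGroup E''] [NormedSpace ℝ E'']
  {M : Type*} [TopologicalSpace M] [ChartedSpace EM M]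
  {G : Type*} [TopologicalSpace G] [ChartedSpace EG G] [Group G]
  {P : Type*} [TopologicalSpace P] [ChartedSpace EP P]
  {N : Type*} [TopologicalSpace N] [ChartedSpace E N]
  {N' : Type*} [TopologicalSpace N'] [ChartedSpace E' N']
  {N'' : Type*} [TopologicalSpace N''] [ChartedSpace E'' N'']

open Filter Topology

/-! ### Derivatives as maps between the model spaces -/

section ModelDerivative

/-- The derivative `mfderiv` of a map between boundaryless manifolds, with the tangent spaces
identified with the model spaces. -/
def tderiv (f : N → N') (s : N) : E →L[ℝ] E' := mfderiv 𝓘(ℝ, E) 𝓘(ℝ, E') f s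

theorem tderiv_comp {g : N' → N''} {f : N → N'} (s : N)
    (hg : MDifferentiableAt 𝓘(ℝ, E') 𝓘(ℝ, E'') g (f s))
    (hf : MDifferentiableAt 𝓘(ℝ, E) 𝓘(ℝ, E') f s) (v : E) :
    tderiv (fun x => g (f x)) s v = (tderiv g (f s) (tderiv f s v : E') : E'') :=
  congrArg (fun L : E →L[ℝ] E'' => L v) (mfderiv_comp s hg hf)

theorem tderiv_id (s : N) (v : E) : tderiv (fun x : N => x) s v = v :=
  congrArg (fun L : E →L[ℝ] E => L v) (mfderiv_id (I := 𝓘(ℝ, E)) (x := s))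

theorem tderiv_const (s : N) (y : N') (v : E) : (tderiv (fun _ : N => y) s v : E') = 0 :=
  congrArg (fun L : E →L[ℝ] E' => L v)
    (mfderiv_const (I := 𝓘(ℝ, E)) (I' := 𝓘(ℝ, E')) (x := s) (c := y))

theorem tderiv_congr {f g : N → N'} {s : N} (h : f =ᶠ[nhds s] g) (v : E) :
    (tderiv f s v : E') = tderiv g s v :=
  congrArg (fun L : E →L[ℝ] E' => L v) (h.mfderiv_eq (I := 𝓘(ℝ, E)) (I' := 𝓘(ℝ, E')))

theorem tderiv_eq_fderiv (f : E → E') (s v : E) : tderiv f s v = fderiv ℝ f s v :=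
  congrArg (fun L : E →L[ℝ] E' => L v) (mfderiv_eq_fderiv (f := f) (x := s))

/-- The product rule, for a function of two variables. -/
theorem tderiv_map₂ {f : N → N'} {k : N → N''} {Q : Type*} [TopologicalSpace Q]
    {EQ : Type*} [NormedAddCommGroup EQ] [NormedSpace ℝ EQ] [ChartedSpace EQ Q]
    {m : N' × N'' → Q} {s : N}
    (hm : MDifferentiableAt (𝓘(ℝ, E').prod 𝓘(ℝ, E'')) 𝓘(ℝ, EQ) m (f s, k s))
    (hf : MDifferentiableAt 𝓘(ℝ, E) 𝓘(ℝ, E') f s)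
    (hk : MDifferentiableAt 𝓘(ℝ, E) 𝓘(ℝ, E'') k s) (v : E) :
    (tderiv (fun x => m (f x, k x)) s v : EQ) =
      tderiv (fun x => m (x, k s)) (f s) (tderiv f s v : E') +
        tderiv (fun x => m (f s, x)) (k s) (tderiv k s v : E'') := by
  have h1 := mfderiv_comp s hm (hf.prodMk hk)
  have h2 : ∀ w : E' × E'', mfderiv (𝓘(ℝ, E').prod 𝓘(ℝ, E'')) 𝓘(ℝ, EQ) m (f s, k s) w =
      ((tderiv (fun x => m (x, k s)) (f s) w.1 + tderiv (fun x => m (f s, x)) (k s) w.2 : EQ)) :=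
    fun w => mfderiv_prod_eq_add_apply hm
  have h3 := mfderiv_prodMk hf hk
  refine (congrArg (fun L : E →L[ℝ] EQ => L v) h1).trans ?_
  refine (h2 _).trans ?_
  have h4 : (mfderiv 𝓘(ℝ, E) (𝓘(ℝ, E').prod 𝓘(ℝ, E'')) (fun x => (f x, k x)) s v : E' × E'') =
      (tderiv f s v, tderiv k s v) := congrArg (fun L : E →L[ℝ] E' × E'' => L v) h3
  exact congrArg (fun w : E' × E'' => ((tderiv (fun x => m (x, k s)) (f s) w.1 +
    tderiv (fun x => m (f s, x)) (k s) w.2 : EQ))) h4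

end ModelDerivative

/-! ### Translations and the adjoint representation on the model space. -/

section LieGroup

variable [LieGroup 𝓘(ℝ, EG) ∞ G]

theorem mdifferentiableAt_mul_left (g h : G) :
    MDifferentiableAt 𝓘(ℝ, EG) 𝓘(ℝ, EG) (fun x : G => g * x) h :=
  (contMDiff_mul_left (I := 𝓘(ℝ, EG)) (n := ∞) (a := g)).contMDiffAt.mdifferentiableAt (by simp)

theorem mdifferentiableAt_mul_right (g h : G) :
    MDifferentiableAt 𝓘(ℝ, EG) 𝓘(ℝ, EG) (fun x : G => x * g) h :=
  (contMDiff_mul_right (I := 𝓘(ℝ, EG)) (n := ∞) (a := g)).contMDiffAt.mdifferentiableAt (by simp)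

variable (EG) in
/-- The derivative at `h` of the left translation by `g`, as a map of the model space. -/
def leftDeriv (g h : G) : EG →L[ℝ] EG := tderiv (fun x : G => g * x) h

variable (EG) in
/-- The adjoint representation, as a map of the model space. -/
def adjoint (g : G) : EG →L[ℝ] EG := tderiv (fun h : G => g * h * g⁻¹) 1

variable (EG) in
/-- The derivative at `1` of the right translation by `g`, as a map of the model space. -/
def rightDeriv (g : G) : EG →L[ℝ] EG := tderiv (fun h : G => h * g) 1

theorem leftDeriv_leftDeriv (g g' h : G) (X : EG) :
    leftDeriv EG g (g' * h) (leftDeriv EG g' h X) = leftDeriv EG (g * g') h X := by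
  have h1 := tderiv_comp h (mdifferentiableAt_mul_left (EG := EG) g (g' * h))
    (mdifferentiableAt_mul_left g' h) X
  rw [leftDeriv, leftDeriv, leftDeriv, ← h1]
  congr 3
  ext x
  exact (mul_assoc g g' x).symm

theorem leftDeriv_one (h : G) (X : EG) : leftDeriv EG 1 h X = X := by
  simpa only [leftDeriv, one_mul] using tderiv_id h X

theorem leftDeriv_inv_self_eq_zero_iff (g : G) (X : EG) : leftDeriv EG g⁻¹ g X = 0 ↔ X = 0 := by
  refine ⟨fun h => ?_, fun h => by rw [h, map_zero]⟩
  have := leftDeriv_leftDeriv g g⁻¹ g X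
  rw [h, map_zero, mul_inv_cancel, leftDeriv_one] at this
  exact this.symm

theorem mdifferentiableAt_conj (g : G) :
    MDifferentiableAt 𝓘(ℝ, EG) 𝓘(ℝ, EG) (fun h : G => g * h * g⁻¹) 1 :=
  (mdifferentiableAt_mul_right g⁻¹ (g * 1)).comp (1 : G) (mdifferentiableAt_mul_left g 1)

/-- Differentiate `g * (g⁻¹ * h * g) = h * g` at `h = 1`. This turns the left-translated terms of
the product rule into the right translation in `U' = -A(c') U`. -/
theorem leftDeriv_adjoint_inv (g : G) (X : EG) :
    leftDeriv EG g 1 (adjoint EG g⁻¹ X) = rightDeriv EG g X := by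
  have h0 : g⁻¹ * 1 * g⁻¹⁻¹ = 1 := by simp
  have h1 := tderiv_comp (g := fun x => g * x) (1 : G)
    (mdifferentiableAt_mul_left (EG := EG) g _) (mdifferentiableAt_conj (EG := EG) g⁻¹) X
  rw [h0] at h1
  rw [leftDeriv, adjoint, ← h1, rightDeriv]
  congr 3
  ext x
  simp [mul_assoc]

theorem adjoint_inv_eq_zero_iff (g : G) (X : EG) : adjoint EG g⁻¹ X = 0 ↔ X = 0 := by
  refine ⟨fun h => ?_, fun h => by rw [h, map_zero]⟩
  have h0 : g⁻¹ * 1 * g⁻¹⁻¹ = 1 := by simp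
  have h1 := tderiv_comp (g := fun x => g * x * g⁻¹) (1 : G)
    (h0.symm ▸ mdifferentiableAt_conj (EG := EG) g) (mdifferentiableAt_conj (EG := EG) g⁻¹) X
  have h2 : (fun x : G => g * (g⁻¹ * x * g⁻¹⁻¹) * g⁻¹) = fun x => x := by
    ext x; simp [mul_assoc]
  rw [h2, tderiv_id] at h1
  rw [h1]
  change tderiv _ _ (adjoint EG g⁻¹ X) = _
  rw [h, map_zero]

end LieGroup

/-! ### The connection form under gauge transformations. -/

section Connection

variable [IsManifold 𝓘(ℝ, EP) ∞ P] [MulAction Gᵐᵒᵖ P] [LieGroup 𝓘(ℝ, EG) ∞ G]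
  {π : P → M} (conn : ConnectionForm EG EP G P)

/-- The connection form, as a map between the model spaces. -/
def ConnectionForm.modelForm (p : P) : EP →L[ℝ] EG := conn.form p

theorem smul_op_mul (p : P) (g h : G) : p <• (g * h) = (p <• g) <• h := by
  rw [MulOpposite.op_mul, mul_smul]

/-- Keeping `g = 1` as a hypothesis allows the use at `(k s)⁻¹ * k s` in `along_smul`; `h8` moves
the form between the equal points `p <• 1` and `p`. -/
theorem ConnectionForm.modelForm_orbit (p : P) {g : G} (hg : g = 1) (X : EG) :
    conn.modelForm p (tderiv (fun g : G => p <• g) g X) = X := by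
  subst hg
  have h8 : ∀ q : P, q = p → ∀ Y : EP, conn.modelForm p Y = conn.modelForm q Y := by
    rintro _ rfl _; rfl
  rw [h8 (p <• (1 : G)) (by simp)]
  exact conn.vertical p X

theorem ConnectionForm.modelForm_translate (g : G) (p : P) (v : EP) :
    conn.modelForm (p <• g) (tderiv (fun q : P => q <• g) p v) =
      adjoint EG g⁻¹ (conn.modelForm p v) :=
  conn.equivariant g p v

theorem mdifferentiableAt_act (hπ : IsPrincipalBundle EM EG EP G π) (p : P) (g : G) :
    MDifferentiableAt (𝓘(ℝ, EP).prod 𝓘(ℝ, EG)) 𝓘(ℝ, EP) (fun q : P × G => q.1 <• q.2) (p, g) :=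
  hπ.smooth_act.contMDiffAt.mdifferentiableAt (by simp)

theorem mdifferentiableAt_orbit (hπ : IsPrincipalBundle EM EG EP G π) (p : P) (g : G) :
    MDifferentiableAt 𝓘(ℝ, EG) 𝓘(ℝ, EP) (fun h : G => p <• h) g :=
  (hπ.smooth_act.comp (contMDiff_const.prodMk contMDiff_id)).contMDiffAt.mdifferentiableAt
    (by simp)

/-- The value of the connection form on the derivative of `f` in the direction `v`. -/
def ConnectionForm.along (f : N → P) (s : N) (v : E) : EG := conn.modelForm (f s) (tderiv f s v)

/-- The product rule for the right action, evaluated on the connection form. -/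
theorem ConnectionForm.along_smul (hπ : IsPrincipalBundle EM EG EP G π) {f : N → P} {k : N → G}
    {s : N} (hf : MDifferentiableAt 𝓘(ℝ, E) 𝓘(ℝ, EP) f s)
    (hk : MDifferentiableAt 𝓘(ℝ, E) 𝓘(ℝ, EG) k s) (v : E) :
    conn.along (fun s => f s <• k s) s v =
      adjoint EG (k s)⁻¹ (conn.along f s v) + leftDeriv EG (k s)⁻¹ (k s) (tderiv k s v) := by
  -- The orbit map of `f s` is rewritten as the orbit map of `f s <• k s` after left translation by
  -- `(k s)⁻¹`; its derivative is then a fundamental vector at the right point.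
  have h1 := tderiv_comp (f := fun g : G => (k s)⁻¹ * g) (k s)
    (mdifferentiableAt_orbit hπ (f s <• k s) ((k s)⁻¹ * k s))
    (mdifferentiableAt_mul_left (EG := EG) (k s)⁻¹ (k s)) (tderiv k s v)
  have h2 : (fun g : G => (f s <• k s) <• ((k s)⁻¹ * g)) = fun g => f s <• g := by
    ext g
    rw [← smul_op_mul, mul_inv_cancel_left]
  rw [h2] at h1
  have h3 := tderiv_map₂ (mdifferentiableAt_act hπ (f s) (k s)) hf hk v
  simp only at h3
  rw [ConnectionForm.along, h3, map_add, conn.modelForm_translate, h1,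
    conn.modelForm_orbit _ (inv_mul_cancel _)]
  rfl

/-- Two horizontal maps which differ by the gauge transformation `k`: `k` has derivative zero. -/
theorem ConnectionForm.tderiv_eq_zero_of_along_eq_zero (hπ : IsPrincipalBundle EM EG EP G π)
    {f : N → P} {k : N → G} {s : N} (hf : MDifferentiableAt 𝓘(ℝ, E) 𝓘(ℝ, EP) f s)
    (hk : MDifferentiableAt 𝓘(ℝ, E) 𝓘(ℝ, EG) k s) {v : E} (h1 : conn.along f s v = 0)
    (h2 : conn.along (fun s => f s <• k s) s v = 0) : (tderiv k s v : EG) = 0 := by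
  rwa [conn.along_smul hπ hf hk, h1, map_zero, zero_add, leftDeriv_inv_self_eq_zero_iff] at h2

theorem ConnectionForm.along_smul_const (hπ : IsPrincipalBundle EM EG EP G π)
    {f : N → P} {s : N} (hf : MDifferentiableAt 𝓘(ℝ, E) 𝓘(ℝ, EP) f s) (g : G) (v : E) :
    conn.along (fun s => f s <• g) s v = adjoint EG g⁻¹ (conn.along f s v) := by
  rw [conn.along_smul hπ (k := fun _ => g) hf mdifferentiableAt_const, tderiv_const, map_zero,
    add_zero]

/-- In terms of the gauge transformation `k` with `A = k⁻¹ dk`, the translate of `f` by `k⁻¹` is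
horizontal. -/
theorem ConnectionForm.along_smul_inv_eq_zero (hπ : IsPrincipalBundle EM EG EP G π)
    {f : N → P} {k : N → G} {s : N} (hf : MDifferentiableAt 𝓘(ℝ, E) 𝓘(ℝ, EP) f s)
    (hk : MDifferentiableAt 𝓘(ℝ, E) 𝓘(ℝ, EG) k s) {v : E}
    (h : (tderiv k s v : EG) = leftDeriv EG (k s) 1 (conn.along f s v)) :
    conn.along (fun s => f s <• (k s)⁻¹) s v = 0 := by
  have hk' : MDifferentiableAt 𝓘(ℝ, E) 𝓘(ℝ, EG) (fun s => (k s)⁻¹) s :=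
    ((contMDiff_inv 𝓘(ℝ, EG) ∞).contMDiffAt.mdifferentiableAt (by simp)).comp s hk
  have hf' : MDifferentiableAt 𝓘(ℝ, E) 𝓘(ℝ, EP) (fun s => f s <• (k s)⁻¹) s :=
    (mdifferentiableAt_act hπ (f s) (k s)⁻¹).comp s (hf.prodMk hk')
  -- The product rule is applied to `f = (f · k⁻¹) · k`, so no derivative of the inversion has to be
  -- computed.
  have h1 := conn.along_smul hπ hf' hk v
  have h2 : (fun s => (f s <• (k s)⁻¹) <• k s) = f := by
    ext s
    rw [← smul_op_mul, inv_mul_cancel, MulOpposite.op_one, one_smul]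
  have h3 := leftDeriv_leftDeriv (k s)⁻¹ (k s) 1 (conn.along f s v)
  rw [mul_one, inv_mul_cancel, leftDeriv_one] at h3
  rw [h2, h, h3, right_eq_add] at h1
  rwa [adjoint_inv_eq_zero_iff] at h1

/-- `f · k` is horizontal if and only if `k' = - A · k`, where `A` is the connection along `f`. -/
theorem ConnectionForm.along_smul_eq_zero_iff (hπ : IsPrincipalBundle EM EG EP G π)
    {f : N → P} {k : N → G} {s : N} (hf : MDifferentiableAt 𝓘(ℝ, E) 𝓘(ℝ, EP) f s)
    (hk : MDifferentiableAt 𝓘(ℝ, E) 𝓘(ℝ, EG) k s) (v : E) :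
    conn.along (fun s => f s <• k s) s v = 0 ↔
      (tderiv k s v : EG) = -rightDeriv EG (k s) (conn.along f s v) := by
  have h3 := leftDeriv_leftDeriv (k s) (k s)⁻¹ (k s) (tderiv k s v : EG)
  rw [inv_mul_cancel, mul_inv_cancel, leftDeriv_one] at h3
  have h4 := leftDeriv_leftDeriv (k s)⁻¹ (k s) 1 (adjoint EG (k s)⁻¹ (conn.along f s v))
  rw [mul_one, inv_mul_cancel, leftDeriv_one, leftDeriv_adjoint_inv] at h4
  rw [conn.along_smul hπ hf hk]
  constructor
  · intro h
    rw [← h3, ← leftDeriv_adjoint_inv, ← map_neg]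
    congr 1
    exact eq_neg_of_add_eq_zero_right h
  · intro h
    rw [h, map_neg, h4, add_neg_cancel]

end Connection

/-! ### Derivatives of charts. -/

section Charts

theorem mdifferentiable_chartAt [IsManifold 𝓘(ℝ, E) ∞ N] (x : N) :
    (chartAt E x).MDifferentiable 𝓘(ℝ, E) 𝓘(ℝ, E) :=
  ⟨(contMDiffOn_chart (n := ∞)).mdifferentiableOn (by simp),
    (contMDiffOn_chart_symm (n := ∞)).mdifferentiableOn (by simp)⟩

theorem isInvertible_mfderiv_chartAt_symm [IsManifold 𝓘(ℝ, E) ∞ N] (x : N) {y : E}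
    (hy : y ∈ (chartAt E x).target) :
    (mfderiv 𝓘(ℝ, E) 𝓘(ℝ, E) (chartAt E x).symm y).IsInvertible :=
  ⟨(mdifferentiable_chartAt x).symm.mfderiv hy, rfl⟩

end Charts

/-! ### Left-invariant fields in a chart of the group. -/

section LieAlgebra

variable [LieGroup 𝓘(ℝ, EG) ∞ G]

theorem lieGroup_three : LieGroup 𝓘(ℝ, EG) (minSmoothness ℝ 3) G := by
  rw [minSmoothness_of_isRCLikeNormedField]
  exact LieGroup.of_le (m := 3) (n := ∞) (WithTop.coe_le_coe.2 le_top)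

variable (EG G) in
/-- The left-invariant vector field of `X`, read in the chart around `1` at the point with
coordinates `u`. -/
def chartField (u : EG) : EG →L[ℝ] EG :=
  (tderiv (chartAt EG (1 : G)) ((chartAt EG (1 : G)).symm u) : EG →L[ℝ] EG).comp
    (leftDeriv EG ((chartAt EG (1 : G)).symm u) 1)

theorem tderiv_chartAt_symm_chartField {u : EG} (hu : u ∈ (chartAt EG (1 : G)).target) (X : EG) :
    (tderiv (chartAt EG (1 : G)).symm u (chartField EG G u X) : EG) =
      leftDeriv EG ((chartAt EG (1 : G)).symm u) 1 X := by
  have : IsManifold 𝓘(ℝ, EG) ∞ G := inferInstance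
  have h := (mdifferentiable_chartAt (1 : G)).symm.comp_symm_deriv (x := (chartAt EG (1 : G)).symm u)
    ((chartAt EG (1 : G)).map_target hu)
  have h1 := congrArg (fun L : EG →L[ℝ] EG => L (leftDeriv EG ((chartAt EG (1 : G)).symm u) 1 X)) h
  have h2 : (chartAt EG (1 : G)) ((chartAt EG (1 : G)).symm u) = u :=
    (chartAt EG (1 : G)).right_inv hu
  have h3 : ∀ w : EG, w = u → ∀ Y : EG, (tderiv (chartAt EG (1 : G)).symm w Y : EG) =
      tderiv (chartAt EG (1 : G)).symm u Y := by rintro _ rfl _; rfl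
  exact (h3 _ h2 _).symm.trans h1

/-- The left-invariant vector field of `X`. -/
def leftField (X : EG) (g : G) : TangentSpace 𝓘(ℝ, EG) g := mulInvariantVectorField (I := 𝓘(ℝ, EG))
  (G := G) X g

/-- Through this identity the regularity and the bracket of invariant fields on `G` are carried to
the chart. -/
theorem chartField_eq_mpullback {u : EG} (hu : u ∈ (chartAt EG (1 : G)).target) (X : EG) :
    (VectorField.mpullback 𝓘(ℝ, EG) 𝓘(ℝ, EG) (chartAt EG (1 : G)).symm (leftField X) u : EG) =
      chartField EG G u X := by
  have h1 := tderiv_chartAt_symm_chartField (G := G) hu X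
  have h2 := (isInvertible_mfderiv_chartAt_symm (1 : G) hu).inverse_apply_self
    (chartField EG G u X)
  refine Eq.trans ?_ h2
  exact congrArg (fun Y : EG =>
    ((mfderiv 𝓘(ℝ, EG) 𝓘(ℝ, EG) (chartAt EG (1 : G)).symm u).inverse Y : EG)) h1.symm

theorem contDiffOn_chartField [FiniteDimensional ℝ EG] :
    ContDiffOn ℝ 2 (chartField EG G) (chartAt EG (1 : G)).target := by
  have : LieGroup 𝓘(ℝ, EG) (minSmoothness ℝ 3) G := lieGroup_three
  have : IsManifold 𝓘(ℝ, EG) 1 G := IsManifold.of_le (n := ∞) (by simp)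
  refine contDiffOn_clm_apply.2 fun X u hu => ?_
  have ho := (chartAt EG (1 : G)).open_target.mem_nhds hu
  have hs : ContMDiffAt 𝓘(ℝ, EG) 𝓘(ℝ, EG) 3 (chartAt EG (1 : G)).symm u :=
    ((contMDiffOn_chart_symm (n := ∞)).contMDiffAt ho).of_le (WithTop.coe_le_coe.2 le_top)
  have hV := contMDiffAt_mulInvariantVectorField (I := 𝓘(ℝ, EG)) (G := G) X
    (g := (chartAt EG (1 : G)).symm u)
  have h1 := ContMDiffAt.mpullback_vectorField_preimage (m := 2) (hV.of_le le_minSmoothness) hs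
    (isInvertible_mfderiv_chartAt_symm (1 : G) hu) (by norm_num)
  have h2 := contMDiffAt_vectorSpace_iff_contDiffAt.1 h1
  refine (h2.congr_of_eventuallyEq ?_).contDiffWithinAt
  filter_upwards [ho] with w hw
  exact (chartField_eq_mpullback hw X).symm

variable (G) in
/-- The Lie bracket, on the model space. -/
def modelBracket (X Y : EG) : EG :=
  Bracket.bracket (L := GroupLieAlgebra 𝓘(ℝ, EG) G) (M := GroupLieAlgebra 𝓘(ℝ, EG) G) X Y

/-- The Maurer–Cartan equation in coordinates: pull-back commutes with brackets of vector fields,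
and the bracket of two invariant fields is the invariant field of the Lie bracket. -/
theorem chartField_bracket [FiniteDimensional ℝ EG] {u : EG}
    (hu : u ∈ (chartAt EG (1 : G)).target) (X Y : EG) :
    fderiv ℝ (chartField EG G) u (chartField EG G u X) Y -
      fderiv ℝ (chartField EG G) u (chartField EG G u Y) X = chartField EG G u (modelBracket G X Y) := by
  have : LieGroup 𝓘(ℝ, EG) (minSmoothness ℝ 3) G := lieGroup_three
  have : IsManifold 𝓘(ℝ, EG) (minSmoothness ℝ 2) G := by
    rw [minSmoothness_of_isRCLikeNormedField]
    exact IsManifold.of_le (n := ∞) (WithTop.coe_le_coe.2 le_top)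
  have : IsManifold 𝓘(ℝ, EG) (minSmoothness ℝ 2) EG := inferInstance
  have ho := (chartAt EG (1 : G)).open_target.mem_nhds hu
  have hs : ContMDiffAt 𝓘(ℝ, EG) 𝓘(ℝ, EG) 3 (chartAt EG (1 : G)).symm u :=
    ((contMDiffOn_chart_symm (n := ∞)).contMDiffAt ho).of_le (WithTop.coe_le_coe.2 le_top)
  have h1 := VectorField.mpullback_mlieBracket (x₀ := u)
    (mdifferentiableAt_mulInvariantVectorField (I := 𝓘(ℝ, EG)) (G := G) X)
    (mdifferentiableAt_mulInvariantVectorField (I := 𝓘(ℝ, EG)) (G := G) Y) hs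
    (by rw [minSmoothness_of_isRCLikeNormedField]; norm_num)
  have h0 := congrArg (fun V => VectorField.mpullback 𝓘(ℝ, EG) 𝓘(ℝ, EG) (chartAt EG (1 : G)).symm V u)
    (mulInvariantVector_mlieBracket (I := 𝓘(ℝ, EG)) (G := G) X Y)
  have hE : ∀ V W : EG → EG, (VectorField.mlieBracket 𝓘(ℝ, EG) V W u : EG) =
      VectorField.lieBracket ℝ V W u := fun V W => by
    have h := congrFun (VectorField.mlieBracketWithin_eq_lieBracketWithin (𝕜 := ℝ) (V := V)
      (W := W) (s := univ)) u
    rwa [VectorField.lieBracketWithin_univ] at h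
  have hd : DifferentiableAt ℝ (chartField EG G) u :=
    (contDiffOn_chartField.contDiffAt ho).differentiableAt (by simp)
  have hf : ∀ X : EG, (VectorField.mpullback 𝓘(ℝ, EG) 𝓘(ℝ, EG) (chartAt EG (1 : G)).symm
      (leftField X) : EG → EG) =ᶠ[nhds u] fun u => chartField EG G u X := fun X => by
    filter_upwards [ho] with w hw
    exact chartField_eq_mpullback hw X
  have hf' : ∀ X v : EG, fderiv ℝ (VectorField.mpullback 𝓘(ℝ, EG) 𝓘(ℝ, EG)
      (chartAt EG (1 : G)).symm (leftField X) : EG → EG) u v =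
      fderiv ℝ (chartField EG G) u v X := fun X v => by
    rw [(hf X).fderiv_eq, fderiv_clm_apply hd (differentiableAt_const X)]
    simp
  have h2 : chartField EG G u (modelBracket G X Y) = VectorField.lieBracket ℝ
      (VectorField.mpullback 𝓘(ℝ, EG) 𝓘(ℝ, EG) (chartAt EG (1 : G)).symm (leftField X) : EG → EG)
      (VectorField.mpullback 𝓘(ℝ, EG) 𝓘(ℝ, EG) (chartAt EG (1 : G)).symm (leftField Y) : EG → EG)
      u := 
    (chartField_eq_mpullback hu _).symm.trans (h0.trans (h1.trans (hE _ _)))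
  rw [h2]
  refine Eq.trans ?_ (Eq.symm (congrFun VectorField.lieBracket_eq u))
  refine (congrArg₂ (· - ·) ((hf' Y _).trans ?_) ((hf' X _).trans ?_)).symm
  · exact congrArg (fun v => fderiv ℝ (chartField EG G) u v Y) (chartField_eq_mpullback hu X)
  · exact congrArg (fun v => fderiv ℝ (chartField EG G) u v X) (chartField_eq_mpullback hu Y)

end LieAlgebra

/-! ### From vanishing field strength to local horizontal sections. -/

section Gauge

variable [IsManifold 𝓘(ℝ, EP) ∞ P] [MulAction Gᵐᵒᵖ P] [LieGroup 𝓘(ℝ, EG) ∞ G]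
  {π : P → M} (conn : ConnectionForm EG EP G P)

/-- The pull-back of the connection form under a map, on the model spaces. -/
def ConnectionForm.modelPotential (s : E → P) (y : E) : E →L[ℝ] EG :=
  (conn.modelForm (s y)).comp (tderiv s y)

theorem ConnectionForm.along_comp {f : N' → P} {h : N → N'} {s : N}
    (hf : MDifferentiableAt 𝓘(ℝ, E') 𝓘(ℝ, EP) f (h s))
    (hh : MDifferentiableAt 𝓘(ℝ, E) 𝓘(ℝ, E') h s) (v : E) :
    conn.along (fun x => f (h x)) s v = conn.along f (h s) (tderiv h s v : E') := by
  rw [along, along, tderiv_comp s hf hh]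

/-- In finite dimension smoothness may be tested on a fixed vector `v`, where the potential is the
connection form after the tangent map of `s` on a constant field. -/
theorem ConnectionForm.contDiffOn_modelPotential [FiniteDimensional ℝ E] {s : E → P} {D : Set E}
    (hD : IsOpen D) (hs : ContMDiffOn 𝓘(ℝ, E) 𝓘(ℝ, EP) ∞ s D) :
    ContDiffOn ℝ ∞ (conn.modelPotential s) D := by
  refine contDiffOn_clm_apply.2 fun v => ?_
  have h1 := hs.contMDiffOn_tangentMapWithin (m := ∞) (by simp) hD.uniqueMDiffOn
  have h2 : ContMDiff 𝓘(ℝ, E) 𝓘(ℝ, E).tangent ∞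
      (fun y : E => (⟨y, v⟩ : TangentBundle 𝓘(ℝ, E) E)) := fun y =>
    contMDiffAt_vectorSpace_iff_contDiffAt.2 contDiffAt_const
  have h3 := conn.smooth.comp_contMDiffOn (h1.comp h2.contMDiffOn (s := D) fun y hy => hy)
  refine (contMDiffOn_iff_contDiffOn.1 h3).congr fun y hy => ?_
  change conn.modelForm (s y) (tderiv s y v) =
    conn.modelForm (s y) (mfderivWithin 𝓘(ℝ, E) 𝓘(ℝ, EP) s D y v)
  rw [mfderivWithin_of_isOpen hD hy]
  rfl

/-- By the chain rule all components are values of one operator-valued map on a neighbourhood of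
`y`, so their derivatives agree too. This brings flatness into the form needed for the Frobenius
theorem. -/
theorem ConnectionForm.fieldStrength_eq [FiniteDimensional ℝ EM] {W : Set M} {σ : M → P}
    (hσ : IsLocalGauge EM EP π W σ) {φ : OpenPartialHomeomorph M EM}
    (hφ : φ.MDifferentiable 𝓘(ℝ, EM) 𝓘(ℝ, EM))
    {y : EM} (hA : DifferentiableAt ℝ (conn.modelPotential fun y => σ (φ.symm y)) y)
    (hy : y ∈ φ.target) (hyW : φ.symm y ∈ W) (v w : EM) :
    (fieldStrength (conn.gaugePotential (EM := EM) σ) φ y v w : EG) =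
      fderiv ℝ (conn.modelPotential fun y => σ (φ.symm y)) y v w -
      fderiv ℝ (conn.modelPotential fun y => σ (φ.symm y)) y w v +
      modelBracket G (conn.modelPotential (fun y => σ (φ.symm y)) y v)
        (conn.modelPotential (fun y => σ (φ.symm y)) y w) := by
  have hD : φ.target ∩ φ.symm ⁻¹' W ∈ nhds y :=
    (φ.symm.isOpen_inter_preimage hσ.isOpen).mem_nhds ⟨hy, hyW⟩
  have hc : ∀ z ∈ φ.target ∩ φ.symm ⁻¹' W, ∀ u : EM,
      (component (conn.gaugePotential (EM := EM) σ) φ u z : EG) =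
        conn.modelPotential (fun y => σ (φ.symm y)) z u := by
    intro z hz u
    have h1 : MDifferentiableAt 𝓘(ℝ, EM) 𝓘(ℝ, EP) σ (φ.symm z) :=
      (hσ.smooth.contMDiffAt (hσ.isOpen.mem_nhds hz.2)).mdifferentiableAt (by simp)
    have h2 := tderiv_comp z h1 (hφ.mdifferentiableAt_symm hz.1) u
    change conn.modelForm (σ (φ.symm z)) (tderiv σ (φ.symm z) (tderiv φ.symm z u : EM)) = _
    rw [← h2]
    rfl
  have hd : ∀ u v : EM,
      fderiv ℝ (fun z => (component (conn.gaugePotential (EM := EM) σ) φ u z : EG)) y v =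
        fderiv ℝ (conn.modelPotential fun y => σ (φ.symm y)) y v u := by
    intro u v
    have h1 : ∀ c : EM → EG, c =ᶠ[nhds y]
        (fun z => conn.modelPotential (fun y => σ (φ.symm y)) z u) →
        fderiv ℝ c y v = fderiv ℝ (conn.modelPotential fun y => σ (φ.symm y)) y v u := by
      intro c h
      rw [h.fderiv_eq, fderiv_clm_apply hA (differentiableAt_const u)]
      simp
    refine h1 _ ?_
    filter_upwards [hD] with z hz using hc z hz u
  have e1 := hd w v
  have e2 := hd v w
  have e3 := hc y ⟨hy, hyW⟩
  refine congrArg₂ (· + ·) (congrArg₂ (· - ·) e1 e2) ?_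
  exact congrArg₂ (fun X Y : EG => modelBracket G X Y) (e3 v) (e3 w)

variable (π) in
/-- A `C¹` section over an open set whose derivative is annihilated by the connection form. -/
structure ConnectionForm.IsHorizontalSection (W : Set M) (τ : M → P) : Prop where
  isOpen : IsOpen W
  contMDiffOn : ContMDiffOn 𝓘(ℝ, EM) 𝓘(ℝ, EP) 1 τ W
  section_eq : ∀ x ∈ W, π (τ x) = x
  along_eq_zero : ∀ x ∈ W, ∀ v : EM, conn.along τ x v = 0

theorem ConnectionForm.IsHorizontalSection.mdifferentiableAt {conn : ConnectionForm EG EP G P}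
    {W : Set M} {τ : M → P} (h : conn.IsHorizontalSection (EM := EM) π W τ) {x : M} (hx : x ∈ W) :
    MDifferentiableAt 𝓘(ℝ, EM) 𝓘(ℝ, EP) τ x :=
  (h.contMDiffOn.contMDiffAt (h.isOpen.mem_nhds hx)).mdifferentiableAt (by simp)

theorem ConnectionForm.IsHorizontalSection.smul {conn : ConnectionForm EG EP G P}
    (hπ : IsPrincipalBundle EM EG EP G π)
    {W : Set M} {τ : M → P} (h : conn.IsHorizontalSection (EM := EM) π W τ) (g : G) :
    conn.IsHorizontalSection (EM := EM) π W (fun x => τ x <• g) where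
  isOpen := h.isOpen
  contMDiffOn := (hπ.smooth_act.of_le (by simp)).comp_contMDiffOn
    (h.contMDiffOn.prodMk contMDiffOn_const)
  section_eq x hx := by rw [hπ.proj_act, h.section_eq x hx]
  along_eq_zero x hx v := by
    rw [conn.along_smul_const hπ (h.mdifferentiableAt hx), h.along_eq_zero x hx, map_zero]

/-- The integrability condition for a flat gauge potential `A`: the equation `dk = k A`, read in
the chart around `1`, has local solutions. -/
theorem exists_hasFDerivAt_chartField [FiniteDimensional ℝ E] [FiniteDimensional ℝ EG]
    {A : E → E →L[ℝ] EG} {D : Set E} (hD : IsOpen D) (hA : ContDiffOn ℝ ∞ A D)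
    (hF : ∀ y ∈ D, ∀ v w, fderiv ℝ A y v w - fderiv ℝ A y w v +
      modelBracket G (A y v) (A y w) = 0) {y₀ : E} (hy₀ : y₀ ∈ D) :
    ∃ f : E → EG, ∃ D' ⊆ D, IsOpen D' ∧ y₀ ∈ D' ∧ ContDiffOn ℝ 1 f D' ∧
      ∀ y ∈ D', f y ∈ (chartAt EG (1 : G)).target ∧
        HasFDerivAt f ((chartField EG G (f y)).comp (A y)) y := by
  have : CompleteSpace EG := FiniteDimensional.complete ℝ EG
  set T := (chartAt EG (1 : G)).target with hT
  have hTo : IsOpen T := (chartAt EG (1 : G)).open_target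
  have h1T : chartAt EG (1 : G) 1 ∈ T := mem_chart_target EG 1
  set Φ : E × EG → E →L[ℝ] EG := fun p => (chartField EG G p.2).comp (A p.1) with hΦ
  have hc : ContDiffOn ℝ 2 (chartField EG G) T := contDiffOn_chartField
  have hA2 : ContDiffOn ℝ 2 A D := hA.of_le (WithTop.coe_le_coe.2 le_top)
  have hΦc : ContDiffOn ℝ 2 Φ (D ×ˢ T) :=
    (hc.comp contDiffOn_snd fun p hp => hp.2).clm_comp (hA2.comp contDiffOn_fst fun p hp => hp.1)
  have hDT : IsOpen (D ×ˢ T) := hD.prod hTo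
  -- The difference of the two sides is `chartField` applied to the field strength of `A`: the terms
  -- in `fderiv A` give its exterior derivative, and `chartField_bracket` gives the bracket term.
  have hint : ∀ p ∈ D ×ˢ T, ∀ v w,
      fderiv ℝ Φ p (v, Φ p v) w = fderiv ℝ Φ p (w, Φ p w) v := by
    rintro ⟨y, u⟩ ⟨hy, hu⟩ v w
    have hdA : DifferentiableAt ℝ A y :=
      (hA2.contDiffAt (hD.mem_nhds hy)).differentiableAt (by simp)
    have hdc : DifferentiableAt ℝ (chartField EG G) u :=
      (hc.contDiffAt (hTo.mem_nhds hu)).differentiableAt (by simp)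
    have hd1 : HasFDerivAt (fun p : E × EG => A p.1)
        ((fderiv ℝ A y).comp (ContinuousLinearMap.fst ℝ E EG)) (y, u) :=
      HasFDerivAt.comp (y, u) (f := Prod.fst) hdA.hasFDerivAt hasFDerivAt_fst
    have hd2 : HasFDerivAt (fun p : E × EG => chartField EG G p.2)
        ((fderiv ℝ (chartField EG G) u).comp (ContinuousLinearMap.snd ℝ E EG)) (y, u) :=
      HasFDerivAt.comp (y, u) (f := Prod.snd) hdc.hasFDerivAt hasFDerivAt_snd
    have hd3 : ∀ (a : E) (b : EG) (c : E), fderiv ℝ Φ (y, u) (a, b) c =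
        chartField EG G u (fderiv ℝ A y a c) + fderiv ℝ (chartField EG G) u b (A y c) := by
      intro a b c
      rw [(hd2.clm_comp hd1).fderiv]
      simp
    rw [hd3, hd3]
    have hbr := chartField_bracket (G := G) hu (A y v) (A y w)
    have hfl := congrArg (chartField EG G u) (hF y hy v w)
    rw [map_add, map_sub, map_zero, ← hbr] at hfl
    have hΦe : ∀ c, Φ (y, u) c = chartField EG G u (A y c) := fun _ => rfl
    rw [hΦe, hΦe, ← sub_eq_zero, ← hfl]
    abel
  obtain ⟨f, hf0, hf⟩ := exists_hasFDerivAt_of_integrable (Φ := Φ) (x₀ := y₀)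
    (u₀ := chartAt EG (1 : G) 1) (hΦc.contDiffAt (hDT.mem_nhds ⟨hy₀, h1T⟩))
    (Filter.mem_of_superset (hDT.mem_nhds ⟨hy₀, h1T⟩) hint)
  have hfc : ContinuousAt f y₀ := hf.self_of_nhds.continuousAt
  have hfT : ∀ᶠ y in nhds y₀, f y ∈ T := hfc (hTo.mem_nhds (hf0 ▸ h1T))
  obtain ⟨D', hD', hD'o, hy₀'⟩ := eventually_nhds_iff.1 ((hf.and hfT).and (hD.mem_nhds hy₀))
  refine ⟨f, D', fun y hy => (hD' y hy).2, hD'o, hy₀', ?_, fun y hy =>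
    ⟨(hD' y hy).1.2, (hD' y hy).1.1⟩⟩
  have hdf : DifferentiableOn ℝ f D' := fun y hy =>
    (hD' y hy).1.1.differentiableAt.differentiableWithinAt
  rw [show (1 : WithTop ℕ∞) = 0 + 1 by simp, contDiffOn_succ_iff_fderiv_of_isOpen hD'o]
  refine ⟨hdf, by simp, contDiffOn_zero.2 ?_⟩
  -- The equation itself upgrades `f` to `C¹`: its derivative `Φ (y, f y)` is continuous because `f`
  -- is.
  refine ContinuousOn.congr (f := fun y => Φ (y, f y)) ?_ fun y hy => (hD' y hy).1.1.fderiv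
  exact hΦc.continuousOn.comp (continuousOn_id.prodMk hdf.continuousOn) fun y hy =>
    ⟨(hD' y hy).2, (hD' y hy).1.2⟩

/-- A flat connection has a horizontal section around each point. -/
theorem ConnectionForm.IsFlat.exists_isHorizontalSection [FiniteDimensional ℝ EM]
    [FiniteDimensional ℝ EG] [IsManifold 𝓘(ℝ, EM) ∞ M]
    {conn : ConnectionForm EG EP G P} (hconn : conn.IsFlat (EM := EM) π)
    (hπ : IsPrincipalBundle EM EG EP G π) (x₀ : M) :
    ∃ W τ, x₀ ∈ W ∧ conn.IsHorizontalSection (EM := EM) π W τ := by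
  obtain ⟨e, hx₀, -, hes, -⟩ := hπ.locally_trivial x₀
  set σ : M → P := fun x => e.toOpenPartialHomeomorph.symm (x, 1) with hσd
  have hmem : ∀ x ∈ e.baseSet, (x, (1 : G)) ∈ e.target := fun x hx => by
    rw [e.mem_target]; exact hx
  have hσ : IsLocalGauge EM EP π e.baseSet σ := by
    refine ⟨e.open_baseSet, ?_, fun x hx => e.proj_symm_apply (hmem x hx)⟩
    exact hes.comp (contMDiffOn_id.prodMk contMDiffOn_const) hmem
  set φ := chartAt EM x₀ with hφ
  have hφd : φ.MDifferentiable 𝓘(ℝ, EM) 𝓘(ℝ, EM) := mdifferentiable_chartAt x₀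
  set D := φ.target ∩ φ.symm ⁻¹' e.baseSet with hDd
  have hD : IsOpen D := φ.symm.isOpen_inter_preimage e.open_baseSet
  have hx₀φ : x₀ ∈ φ.source := mem_chart_source EM x₀
  have hy₀ : φ x₀ ∈ D := ⟨φ.map_source hx₀φ, by simpa [φ.left_inv hx₀φ] using hx₀⟩
  set s : EM → P := fun y => σ (φ.symm y) with hsd
  have hs : ContMDiffOn 𝓘(ℝ, EM) 𝓘(ℝ, EP) ∞ s D :=
    hσ.smooth.comp ((contMDiffOn_chart_symm (n := ∞)).mono inter_subset_left) fun y hy => hy.2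
  have hA := conn.contDiffOn_modelPotential hD hs
  have hF : ∀ y ∈ D, ∀ v w, fderiv ℝ (conn.modelPotential s) y v w -
      fderiv ℝ (conn.modelPotential s) y w v +
      modelBracket G (conn.modelPotential s y v) (conn.modelPotential s y w) = 0 := by
    intro y hy v w
    rw [← conn.fieldStrength_eq hσ hφd
      ((hA.contDiffAt (hD.mem_nhds hy)).differentiableAt (by simp)) hy.1 hy.2]
    exact hconn e.baseSet σ hσ φ (chart_mem_atlas EM x₀) y hy.1 hy.2 v w
  obtain ⟨f, D', hD'D, hD', hy₀', hfc, hf⟩ := exists_hasFDerivAt_chartField (G := G) hD hA hF hy₀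
  set k : EM → G := fun y => (chartAt EG (1 : G)).symm (f y) with hk
  have hkc : ContMDiffOn 𝓘(ℝ, EM) 𝓘(ℝ, EG) 1 k D' :=
    ((contMDiffOn_chart_symm (n := ∞)).of_le (by simp)).comp hfc.contMDiffOn fun y hy => (hf y hy).1
  -- Since `k` solves `dk = k A`, translating by its inverse cancels the potential.
  set s' : EM → P := fun y => s y <• (k y)⁻¹ with hs'
  have hs'c : ContMDiffOn 𝓘(ℝ, EM) 𝓘(ℝ, EP) 1 s' D' :=
    (hπ.smooth_act.of_le (by simp)).comp_contMDiffOn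
      (((hs.mono hD'D).of_le (by simp)).prodMk
        (((contMDiff_inv 𝓘(ℝ, EG) ∞).of_le (by simp)).comp_contMDiffOn hkc))
  have hs'h : ∀ y ∈ D', ∀ v : EM, conn.along s' y v = 0 := by
    intro y hy v
    refine conn.along_smul_inv_eq_zero hπ
      ((hs.contMDiffAt (hD.mem_nhds (hD'D hy))).mdifferentiableAt (by simp))
      ((hkc.contMDiffAt (hD'.mem_nhds hy)).mdifferentiableAt (by simp)) ?_
    have h1 := tderiv_comp y ((mdifferentiable_chartAt (1 : G)).mdifferentiableAt_symm (hf y hy).1)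
      (hf y hy).2.differentiableAt.mdifferentiableAt v
    rw [hk, h1, tderiv_eq_fderiv, (hf y hy).2.fderiv]
    exact tderiv_chartAt_symm_chartField (hf y hy).1 _
  refine ⟨φ.source ∩ φ ⁻¹' D', fun x => s' (φ x), ⟨hx₀φ, hy₀'⟩, ?_⟩
  refine ⟨φ.isOpen_inter_preimage hD', ?_, fun x hx => ?_, fun x hx v => ?_⟩
  · exact hs'c.comp (((contMDiffOn_chart (n := ∞)).of_le (by simp)).mono inter_subset_left)
      fun x hx => hx.2
  · simp only [hs', hsd, hπ.proj_act]
    rw [hσ.section_eq _ (hD'D hx.2).2, φ.left_inv hx.1]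
  · rw [conn.along_comp ((hs'c.contMDiffAt (hD'.mem_nhds hx.2)).mdifferentiableAt (by simp))
      (hφd.mdifferentiableAt hx.1)]
    exact hs'h _ hx.2 _

end Gauge

/-- A continuous path whose derivative vanishes off a countable set is constant. -/
theorem eq_of_tderiv_eq_zero [CompleteSpace E] [IsManifold 𝓘(ℝ, E) ∞ N] [T1Space N] {k : ℝ → N}
    {a b : ℝ} {T : Set ℝ} (hT : T.Countable) (hk : ContinuousOn k (Icc a b))
    (hd : ∀ s ∈ Ioo a b \ T, MDifferentiableAt 𝓘(ℝ, ℝ) 𝓘(ℝ, E) k s ∧ (tderiv k s (1 : ℝ) : E) = 0)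
    {s : ℝ} (hs : s ∈ Icc a b) : k s = k a := by
  -- Continuous induction: the set where `k = k a` is closed, and in a chart it extends to the right
  -- of each of its points.
  have hcl : IsClosed ({s | k s = k a} ∩ Icc a b) := by
    rw [inter_comm]
    exact hk.preimage_isClosed_of_isClosed isClosed_Icc (isClosed_singleton (x := k a))
  refine hcl.Icc_subset_of_forall_mem_nhdsWithin rfl ?_ hs
  rintro x ⟨hxa, hx⟩
  set φ := chartAt E (k x) with hφ
  have hsrc : ∀ᶠ y in 𝓝[Icc a b] x, k y ∈ φ.source :=
    (hk x ⟨hx.1, hx.2.le⟩) (φ.open_source.mem_nhds (mem_chart_source E (k x)))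
  have hsrc' : ∀ᶠ y in 𝓝[≥] x, y ∈ Icc a b ∧ k y ∈ φ.source := by
    have h1 : 𝓝[≥] x ≤ 𝓝[Icc a b] x := nhdsWithin_le_of_mem (Icc_mem_nhdsGE_of_mem hx)
    exact h1 (eventually_mem_nhdsWithin.and hsrc)
  obtain ⟨c, hc, hcs⟩ := (mem_nhdsGE_iff_exists_Icc_subset).1 hsrc'
  filter_upwards [Icc_mem_nhdsGT hc] with y hy
  have hsub : Icc x y ⊆ Icc x c := Icc_subset_Icc_right hy.2
  have hcont : ContinuousOn (fun s => φ (k s)) (Icc x y) :=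
    φ.continuousOn.comp (hk.mono fun s hs => (hcs (hsub hs)).1) fun s hs => (hcs (hsub hs)).2
  have hder : ∀ s ∈ Ioo x y \ T, HasDerivAt (fun s => φ (k s)) ((fun _ => 0 : ℝ → E) s) s := by
    rintro s ⟨hs, hsT⟩
    have hs' := hcs (hsub (Ioo_subset_Icc_self hs))
    have hsab : s ∈ Ioo a b := ⟨hx.1.trans_lt hs.1,
      hs.2.trans_le ((hcs ⟨hy.1, hy.2⟩).1.2)⟩
    obtain ⟨h1, h2⟩ := hd s ⟨hsab, hsT⟩
    have h3 : MDifferentiableAt 𝓘(ℝ, E) 𝓘(ℝ, E) φ (k s) :=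
      (mdifferentiable_chartAt (k x)).mdifferentiableAt hs'.2
    have h4 := tderiv_comp s h3 h1 (1 : ℝ)
    rw [h2, map_zero, tderiv_eq_fderiv] at h4
    have h5 : DifferentiableAt ℝ (fun s => φ (k s)) s := (h3.comp s h1).differentiableAt
    have h6 := h5.hasDerivAt
    rw [← fderiv_apply_one_eq_deriv, h4] at h6
    exact h6
  -- The fundamental theorem of calculus for continuous functions tolerates the countable set `T`.
  have h := MeasureTheory.integral_eq_of_hasDerivAt_off_countable_of_le (fun s => φ (k s))
    (fun _ => 0) hy.1 hT hcont hder intervalIntegrable_const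
  rw [intervalIntegral.integral_zero, eq_comm, sub_eq_zero] at h
  have := φ.injOn (hcs ⟨hy.1, hy.2⟩).2 (hcs ⟨le_rfl, hy.1.trans hy.2⟩).2 h
  exact this.trans hxa

/-! ### Division in the fibres of a principal bundle. -/

section Division

variable [MulAction Gᵐᵒᵖ P] {π : P → M}

theorem IsPrincipalBundle.smul_right_injective (hπ : IsPrincipalBundle EM EG EP G π) {p : P}
    {g h : G} (hgh : p <• g = p <• h) : g = h := by
  obtain ⟨e, he, -, -, hmul⟩ := hπ.locally_trivial (π p)
  have h1 := hmul p (e.mem_source.2 he)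
  exact mul_left_cancel ((h1 g).symm.trans ((congrArg (fun q => (e q).2) hgh).trans (h1 h)))

theorem smul_trivialization_eq (hπ : IsPrincipalBundle EM EG EP G π) {e : Bundle.Trivialization G π}
    (hmul : ∀ p ∈ e.source, ∀ g : G, (e (p <• g)).2 = (e p).2 * g) {p q : P} (hp : p ∈ e.source)
    (hpq : π p = π q) : p <• ((e p).2⁻¹ * (e q).2) = q := by
  have hq : q ∈ e.source := e.mem_source.2 (hpq ▸ e.mem_source.1 hp)
  have hr : p <• ((e p).2⁻¹ * (e q).2) ∈ e.source :=
    e.mem_source.2 (by rw [hπ.proj_act]; exact e.mem_source.1 hp)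
  refine e.injOn hr hq (Prod.ext ?_ ?_)
  · exact (e.coe_fst hr).trans (((hπ.proj_act _ _).trans hpq).trans (e.coe_fst hq).symm)
  · exact (hmul p hp _).trans (mul_inv_cancel_left _ _)

open Classical in
/-- The element `g` with `p · g = q`, for two points `p`, `q` of the same fibre. -/
def fibreDiv (p q : P) : G := if h : ∃ g : G, p <• g = q then h.choose else 1

theorem IsPrincipalBundle.smul_fibreDiv (hπ : IsPrincipalBundle EM EG EP G π) {p q : P}
    (hpq : π p = π q) : p <• (fibreDiv p q : G) = q := by
  obtain ⟨e, he, -, -, hmul⟩ := hπ.locally_trivial (π p)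
  have h : ∃ g : G, p <• g = q := ⟨_, smul_trivialization_eq hπ hmul (e.mem_source.2 he) hpq⟩
  rw [fibreDiv, dif_pos h]
  exact h.choose_spec

theorem IsPrincipalBundle.fibreDiv_eq (hπ : IsPrincipalBundle EM EG EP G π) {p q : P} {g : G}
    (h : p <• g = q) : fibreDiv p q = g :=
  hπ.smul_right_injective ((hπ.smul_fibreDiv (by rw [← h, hπ.proj_act])).trans h.symm)

/-- In an equivariant trivialization the division is `(e p).2⁻¹ * (e q).2`. The order `n` is free:
`0` serves for continuity across break points, `1` for horizontality on the pieces. -/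
theorem IsPrincipalBundle.contMDiffWithinAt_fibreDiv [LieGroup 𝓘(ℝ, EG) ∞ G] {n : WithTop ℕ∞}
    (hn : n ≤ ∞)
    (hπ : IsPrincipalBundle EM EG EP G π) {f f' : N → P} {S : Set N} {s : N} (hs : s ∈ S)
    (hf : ContMDiffWithinAt 𝓘(ℝ, E) 𝓘(ℝ, EP) n f S s)
    (hf' : ContMDiffWithinAt 𝓘(ℝ, E) 𝓘(ℝ, EP) n f' S s) (h : ∀ x ∈ S, π (f x) = π (f' x)) :
    ContMDiffWithinAt 𝓘(ℝ, E) 𝓘(ℝ, EG) n (fun x => (fibreDiv (f x) (f' x) : G)) S s := by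
  obtain ⟨e, he, hes, -, hmul⟩ := hπ.locally_trivial (π (f s))
  have hfs : f s ∈ e.source := e.mem_source.2 he
  have hfs' : f' s ∈ e.source := e.mem_source.2 (h s hs ▸ he)
  have h1 : ContMDiffWithinAt 𝓘(ℝ, E) 𝓘(ℝ, EG) n (fun x => (e (f x)).2) S s :=
    contMDiffAt_snd.comp_contMDiffWithinAt s
      (((hes.contMDiffAt (e.open_source.mem_nhds hfs)).of_le hn).comp_contMDiffWithinAt s hf)
  have h2 : ContMDiffWithinAt 𝓘(ℝ, E) 𝓘(ℝ, EG) n (fun x => (e (f' x)).2) S s :=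
    contMDiffAt_snd.comp_contMDiffWithinAt s
      (((hes.contMDiffAt (e.open_source.mem_nhds hfs')).of_le hn).comp_contMDiffWithinAt s hf')
  have h3 : ContMDiffWithinAt 𝓘(ℝ, E) 𝓘(ℝ, EG) n (fun x => (e (f x)).2⁻¹ * (e (f' x)).2) S s :=
    ((contMDiff_mul 𝓘(ℝ, EG) ∞).of_le hn).contMDiffAt.comp_contMDiffWithinAt s
      ((((contMDiff_inv 𝓘(ℝ, EG) ∞).of_le hn).contMDiffAt.comp_contMDiffWithinAt s h1).prodMk h2)
  have h4 : ∀ x ∈ S, f x ∈ e.source →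
      (fibreDiv (f x) (f' x) : G) = (e (f x)).2⁻¹ * (e (f' x)).2 := fun x hx hxs =>
    hπ.fibreDiv_eq (smul_trivialization_eq hπ hmul hxs (h x hx))
  refine h3.congr_of_eventuallyEq ?_ (h4 s hs hfs)
  filter_upwards [self_mem_nhdsWithin,
    hf.continuousWithinAt (e.open_source.mem_nhds hfs)] with x hx hxs using h4 x hx hxs

end Division

/-! ### Horizontal curves over the domain of a horizontal section. -/

section HorizontalPaths

variable [IsManifold 𝓘(ℝ, EP) ∞ P] [MulAction Gᵐᵒᵖ P] [LieGroup 𝓘(ℝ, EG) ∞ G]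
  {π : P → M} {conn : ConnectionForm EG EP G P}

theorem ConnectionForm.along_congr {f g : N → P} {s : N} (h : f =ᶠ[𝓝 s] g) (v : E) :
    conn.along f s v = conn.along g s v := by
  rw [along, along, tderiv_congr h, h.self_of_nhds]

/-- A path which is horizontal off a countable set, over the domain of a horizontal section `τ`,
is a translate of `τ`. -/
theorem ConnectionForm.IsHorizontalSection.eq_smul_of_horizontal [FiniteDimensional ℝ EG]
    [T2Space G]
    (hπ : IsPrincipalBundle EM EG EP G π) {W : Set M} {τ : M → P}
    (hτ : conn.IsHorizontalSection (EM := EM) π W τ) {γ : ℝ → P} {a b : ℝ} {T : Set ℝ}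
    (hT : T.Countable) (hγ : ContinuousOn γ (Icc a b)) (hγW : ∀ s ∈ Icc a b, π (γ s) ∈ W)
    (hd : ∀ s ∈ Ioo a b \ T, ContMDiffAt 𝓘(ℝ, ℝ) 𝓘(ℝ, EP) 1 γ s ∧ conn.along γ s (1 : ℝ) = 0)
    {g : G} (hg : γ a = τ (π (γ a)) <• g) {s : ℝ} (hs : s ∈ Icc a b) :
    γ s = τ (π (γ s)) <• g := by
  have : CompleteSpace EG := FiniteDimensional.complete ℝ EG
  have hsec : ∀ s ∈ Icc a b, π (τ (π (γ s))) = π (γ s) := fun s hs => hτ.section_eq _ (hγW s hs)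
  have hc : ContinuousOn (fun s => τ (π (γ s))) (Icc a b) :=
    hτ.contMDiffOn.continuousOn.comp (hπ.smooth_proj.continuous.comp_continuousOn hγ) hγW
  -- Both `τ ∘ π ∘ γ` and its translate `γ` by `k` are horizontal, so `k` has zero derivative off
  -- `T`.
  set k : ℝ → G := fun s => fibreDiv (τ (π (γ s))) (γ s) with hk
  have hkc : ContinuousOn k (Icc a b) := fun s hs =>
    (hπ.contMDiffWithinAt_fibreDiv (E := ℝ) (n := 0) (by simp) hs
      ((contMDiffOn_zero_iff.2 hc) s hs) ((contMDiffOn_zero_iff.2 hγ) s hs) hsec).continuousWithinAt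
  have hka : k a = g := hπ.fibreDiv_eq hg.symm
  have key := eq_of_tderiv_eq_zero (E := EG) (k := k) hT hkc ?_ hs
  · rw [← hka, ← key]
    exact (hπ.smul_fibreDiv (hsec s hs)).symm
  rintro s ⟨hs, hsT⟩
  have hs' := Ioo_subset_Icc_self hs
  have hnhds : Icc a b ∈ 𝓝 s := Icc_mem_nhds hs.1 hs.2
  obtain ⟨h1, h2⟩ := hd s ⟨hs, hsT⟩
  have hp : ContMDiffAt 𝓘(ℝ, ℝ) 𝓘(ℝ, EM) 1 (fun s => π (γ s)) s :=
    (hπ.smooth_proj.of_le (by simp)).contMDiffAt.comp s h1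
  have hτs : ContMDiffAt 𝓘(ℝ, EM) 𝓘(ℝ, EP) 1 τ (π (γ s)) :=
    hτ.contMDiffOn.contMDiffAt (hτ.isOpen.mem_nhds (hγW s hs'))
  have hτp : ContMDiffAt 𝓘(ℝ, ℝ) 𝓘(ℝ, EP) 1 (fun s => τ (π (γ s))) s :=
    ContMDiffAt.comp (g := τ) s hτs hp
  have hks : ContMDiffAt 𝓘(ℝ, ℝ) 𝓘(ℝ, EG) 1 k s :=
    (hπ.contMDiffWithinAt_fibreDiv (by simp) hs' hτp.contMDiffWithinAt h1.contMDiffWithinAt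
      hsec).contMDiffAt hnhds
  refine ⟨hks.mdifferentiableAt (by simp), ?_⟩
  refine conn.tderiv_eq_zero_of_along_eq_zero hπ (hτp.mdifferentiableAt (by simp))
    (hks.mdifferentiableAt (by simp)) ?_ ?_
  · rw [conn.along_comp (f := τ) (h := fun s => π (γ s)) (hτs.mdifferentiableAt (by simp))
        (hp.mdifferentiableAt (by simp)),
      hτ.along_eq_zero _ (hγW s hs')]
  · have he : (fun s => τ (π (γ s)) <• k s) =ᶠ[𝓝 s] γ := by
      filter_upwards [hnhds] with x hx using hπ.smul_fibreDiv (hsec x hx)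
    exact (conn.along_congr he _).trans h2

end HorizontalPaths

/-! ### The leaf topology and the covering map. -/

section Leaves

variable [IsManifold 𝓘(ℝ, EP) ∞ P] [MulAction Gᵐᵒᵖ P] [LieGroup 𝓘(ℝ, EG) ∞ G]
  {π : P → M} {conn : ConnectionForm EG EP G P}

/-- Two horizontal sections which agree at a point agree in a neighbourhood of that point. -/
theorem ConnectionForm.IsHorizontalSection.eventually_eq [FiniteDimensional ℝ EG] [T2Space G]
    [IsManifold 𝓘(ℝ, EM) ∞ M] (hπ : IsPrincipalBundle EM EG EP G π) {W W' : Set M} {τ τ' : M → P}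
    (hτ : conn.IsHorizontalSection (EM := EM) π W τ)
    (hτ' : conn.IsHorizontalSection (EM := EM) π W' τ') {x₀ : M} (hx : x₀ ∈ W) (hx' : x₀ ∈ W')
    (h : τ' x₀ = τ x₀) : ∀ᶠ x in 𝓝 x₀, τ' x = τ x := by
  set φ := chartAt EM x₀ with hφ
  have hφd : φ.MDifferentiable 𝓘(ℝ, EM) 𝓘(ℝ, EM) := mdifferentiable_chartAt x₀
  have hx₀ : x₀ ∈ φ.source := mem_chart_source EM x₀
  have hopen : IsOpen (φ.target ∩ φ.symm ⁻¹' (W ∩ W')) :=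
    φ.symm.isOpen_inter_preimage (hτ.isOpen.inter hτ'.isOpen)
  have hy₀ : φ x₀ ∈ φ.target ∩ φ.symm ⁻¹' (W ∩ W') :=
    ⟨φ.map_source hx₀, by simpa [φ.left_inv hx₀] using ⟨hx, hx'⟩⟩
  obtain ⟨ε, hε, hball⟩ := Metric.isOpen_iff.1 hopen _ hy₀
  filter_upwards [φ.continuousAt hx₀ (Metric.ball_mem_nhds _ hε), φ.open_source.mem_nhds hx₀]
    with x hxB hxs
  -- Over a straight segment in the chart, `τ'` is a horizontal curve, hence a constant translate of
  -- `τ`; the constant is `1` by the agreement at `x₀`.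
  set l : ℝ → EM := fun s => φ x₀ + s • (φ x - φ x₀) with hl
  have hlB : ∀ s ∈ Icc (0 : ℝ) 1, l s ∈ φ.target ∩ φ.symm ⁻¹' (W ∩ W') := fun s hs =>
    hball ((convex_ball (φ x₀) ε).add_smul_sub_mem (Metric.mem_ball_self hε) hxB hs)
  have hlc : ContMDiff 𝓘(ℝ, ℝ) 𝓘(ℝ, EM) ∞ l :=
    ContDiff.contMDiff (contDiff_const.add (contDiff_id.smul contDiff_const))
  have hc : ∀ s ∈ Icc (0 : ℝ) 1, ContMDiffAt 𝓘(ℝ, ℝ) 𝓘(ℝ, EM) 1 (fun s => φ.symm (l s)) s :=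
    fun s hs => (((contMDiffOn_chart_symm (n := ∞)).contMDiffAt
      (φ.open_target.mem_nhds (hlB s hs).1)).of_le (by simp)).comp s
        ((hlc s).of_le (by simp))
  set γ : ℝ → P := fun s => τ' (φ.symm (l s)) with hγ
  have hγc : ∀ s ∈ Icc (0 : ℝ) 1, ContMDiffAt 𝓘(ℝ, ℝ) 𝓘(ℝ, EP) 1 γ s := fun s hs =>
    (hτ'.contMDiffOn.contMDiffAt (hτ'.isOpen.mem_nhds (hlB s hs).2.2)).comp s (hc s hs)
  have hγπ : ∀ s ∈ Icc (0 : ℝ) 1, π (γ s) = φ.symm (l s) := fun s hs =>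
    hτ'.section_eq _ (hlB s hs).2.2
  have h0 : φ.symm (l 0) = x₀ := by simp [hl, φ.left_inv hx₀]
  have h1 : φ.symm (l 1) = x := by simp [hl, φ.left_inv hxs]
  have i0 : (0 : ℝ) ∈ Icc (0 : ℝ) 1 := by simp
  have i1 : (1 : ℝ) ∈ Icc (0 : ℝ) 1 := by simp
  have key := hτ.eq_smul_of_horizontal hπ (γ := γ) (T := ∅) (g := 1) countable_empty
    (fun s hs => (hγc s hs).continuousAt.continuousWithinAt)
    (fun s hs => by rw [hγπ s hs]; exact (hlB s hs).2.1)
    (fun s hs => ⟨hγc s (Ioo_subset_Icc_self hs.1), by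
      have hs' := Ioo_subset_Icc_self hs.1
      rw [hγ, conn.along_comp (f := τ') (h := fun s => φ.symm (l s))
        (hτ'.mdifferentiableAt (hlB s hs').2.2) ((hc s hs').mdifferentiableAt (by simp)),
        hτ'.along_eq_zero _ (hlB s hs').2.2]⟩)
    (by rw [hγπ 0 i0]; simp [hγ, h0, h]) i1
  rw [hγπ 1 i1] at key
  simpa [hγ, h1] using key

/-- The total space of the bundle with the topology of the leaves of the horizontal foliation. -/
def LeafSpace (_EM : Type*) (_conn : ConnectionForm EG EP G P) (_π : P → M) : Type _ := P

variable (EM π conn) in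
/-- A point of the total space, as a point of the leaf space. -/
def toLeaf (p : P) : LeafSpace EM conn π := p

/-- A point of the leaf space, as a point of the total space. -/
def ofLeaf (p : LeafSpace EM conn π) : P := p

/-- A set is open if its intersection with each horizontal section is open in the base. -/
instance : TopologicalSpace (LeafSpace EM conn π) where
  IsOpen U := ∀ (W : Set M) (τ : M → P), conn.IsHorizontalSection (EM := EM) π W τ →
    IsOpen (W ∩ (fun x => toLeaf EM π conn (τ x)) ⁻¹' U)
  isOpen_univ W τ h := by rw [preimage_univ, inter_univ]; exact h.isOpen
  isOpen_inter U V hU hV W τ h := by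
    have := (hU W τ h).inter (hV W τ h)
    rwa [← inter_inter_distrib_left] at this
  isOpen_sUnion S hS W τ h := by
    rw [preimage_sUnion, inter_iUnion₂]
    exact isOpen_biUnion fun U hU => hS U hU W τ h

/-- The projection of the leaf space to the base. -/
def leafProj (conn : ConnectionForm EG EP G P) (π : P → M) (p : LeafSpace EM conn π) : M :=
  π (ofLeaf p)

theorem isOpen_leaf_iff {U : Set (LeafSpace EM conn π)} : IsOpen U ↔ ∀ (W : Set M) (τ : M → P),
    conn.IsHorizontalSection (EM := EM) π W τ →
      IsOpen (W ∩ (fun x => toLeaf EM π conn (τ x)) ⁻¹' U) := Iff.rfl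

theorem continuous_leafProj : Continuous (leafProj (EM := EM) conn π) := by
  refine continuous_def.2 fun V hV => isOpen_leaf_iff.2 fun W τ h => ?_
  convert h.isOpen.inter hV using 1
  ext x
  refine and_congr_right fun hx => ?_
  change π (τ x) ∈ V ↔ x ∈ V
  rw [h.section_eq x hx]

/-- Local uniqueness: if another section meets the image over a point, the two sections coincide
near that point. -/
theorem ConnectionForm.IsHorizontalSection.isOpen_image [FiniteDimensional ℝ EG] [T2Space G]
    [IsManifold 𝓘(ℝ, EM) ∞ M] (hπ : IsPrincipalBundle EM EG EP G π) {W : Set M} {τ : M → P}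
    (hτ : conn.IsHorizontalSection (EM := EM) π W τ) :
    IsOpen ((fun x => toLeaf EM π conn (τ x)) '' W) := by
  refine isOpen_leaf_iff.2 fun W' τ' hτ' => isOpen_iff_mem_nhds.2 ?_
  rintro x ⟨hx', z, hz, hzx⟩
  have hzx' : τ z = τ' x := hzx
  have hx : z = x := by rw [← hτ.section_eq z hz, hzx', hτ'.section_eq x hx']
  subst hx
  filter_upwards [hτ.eventually_eq hπ hτ' hz hx' hzx'.symm, hτ.isOpen.mem_nhds hz,
    hτ'.isOpen.mem_nhds hx'] with y hy hyW hyW'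
  exact ⟨hyW', y, hyW, hy.symm⟩

theorem ConnectionForm.IsHorizontalSection.continuousOn_leaf {W : Set M} {τ : M → P}
    (hτ : conn.IsHorizontalSection (EM := EM) π W τ) :
    ContinuousOn (fun x => toLeaf EM π conn (τ x)) W :=
  (continuousOn_open_iff hτ.isOpen).2 fun _ hU => isOpen_leaf_iff.1 hU W τ hτ

/-- A copy of a type, with the discrete topology. -/
structure DiscreteCopy (α : Type*) where
  /-- the underlying element -/
  val : α

instance (α : Type*) : TopologicalSpace (DiscreteCopy α) := ⊥

instance (α : Type*) : DiscreteTopology (DiscreteCopy α) := ⟨rfl⟩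

/-- Over `W` the leaf space is the disjoint union of the open sheets `τ · g`, `g ∈ G`. As `G`
already carries its Lie group topology, the sheets are indexed by `DiscreteCopy G`. -/
theorem ConnectionForm.IsHorizontalSection.isEvenlyCovered [FiniteDimensional ℝ EG] [T2Space G]
    [IsManifold 𝓘(ℝ, EM) ∞ M] (hπ : IsPrincipalBundle EM EG EP G π) {W : Set M} {τ : M → P}
    (hτ : conn.IsHorizontalSection (EM := EM) π W τ) {x : M} (hx : x ∈ W) :
    IsEvenlyCovered (leafProj (EM := EM) conn π) x (DiscreteCopy G) := by
  refine ⟨inferInstance, W, hx, hτ.isOpen, hτ.isOpen.preimage continuous_leafProj, ?_⟩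
  have hdiv : ∀ p : P, π p ∈ W → τ (π p) <• (fibreDiv (τ (π p)) p : G) = p := fun p hp =>
    hπ.smul_fibreDiv (hτ.section_eq _ hp)
  refine ⟨{
    toFun := fun p => (⟨π (ofLeaf p.1), p.2⟩, ⟨fibreDiv (τ (π (ofLeaf p.1))) (ofLeaf p.1)⟩)
    invFun := fun q => ⟨toLeaf EM π conn (τ q.1.1 <• q.2.val), by
      change π (τ q.1.1 <• q.2.val) ∈ W
      rw [hπ.proj_act, hτ.section_eq _ q.1.2]; exact q.1.2⟩
    left_inv := fun p => Subtype.ext (hdiv p.1 p.2)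
    right_inv := ?_
    continuous_toFun := ?_
    continuous_invFun := ?_ }, fun _ => rfl⟩
  · rintro ⟨⟨y, hy⟩, ⟨g⟩⟩
    have h1 : π (τ y <• g) = y := by rw [hπ.proj_act, hτ.section_eq _ hy]
    refine Prod.ext (Subtype.ext h1) (congrArg DiscreteCopy.mk ?_)
    change (fibreDiv (τ (π (τ y <• g))) (τ y <• g) : G) = g
    rw [h1]
    exact hπ.fibreDiv_eq rfl
  · refine Continuous.prodMk ?_ ?_
    · exact Continuous.subtype_mk (continuous_leafProj.comp continuous_subtype_val) _
    · refine continuous_discrete_rng.2 fun ⟨g⟩ => ?_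
      convert ((hτ.smul hπ g).isOpen_image hπ).preimage continuous_subtype_val using 1
      refine Set.ext fun ⟨p, hp⟩ => ⟨fun h => ?_, ?_⟩
      · have h' : (fibreDiv (τ (π (ofLeaf p))) (ofLeaf p) : G) = g := congrArg DiscreteCopy.val h
        have := hdiv (ofLeaf p) hp
        rw [h'] at this
        exact ⟨π (ofLeaf p), hp, this⟩
      · rintro ⟨y, hy, hyp⟩
        have hyp' : τ y <• g = ofLeaf p := hyp
        have h1 : π (ofLeaf p) = y := by rw [← hyp', hπ.proj_act, hτ.section_eq _ hy]
        refine congrArg DiscreteCopy.mk ?_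
        change (fibreDiv (τ (π (ofLeaf p))) (ofLeaf p) : G) = g
        rw [h1]
        exact hπ.fibreDiv_eq hyp'
  · refine Continuous.subtype_mk (continuous_prod_of_discrete_right.2 fun ⟨g⟩ => ?_) _
    exact continuousOn_iff_continuous_domRestrict.1 (hτ.smul hπ g).continuousOn_leaf

/-- For a flat connection, the leaf space is a covering of the base. -/
theorem ConnectionForm.IsFlat.isCoveringMap [FiniteDimensional ℝ EM]
    [FiniteDimensional ℝ EG] [IsManifold 𝓘(ℝ, EM) ∞ M] [T2Space G]
    (hconn : conn.IsFlat (EM := EM) π) (hπ : IsPrincipalBundle EM EG EP G π) :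
    IsCoveringMap (leafProj (EM := EM) conn π) := fun x => by
  obtain ⟨W, τ, hx, hτ⟩ := hconn.exists_isHorizontalSection hπ x
  exact (hτ.isEvenlyCovered hπ hx).to_isEvenlyCovered_preimage

/-- For a flat connection, there is a horizontal section through each point. -/
theorem ConnectionForm.IsFlat.exists_isHorizontalSection_through [FiniteDimensional ℝ EM]
    [FiniteDimensional ℝ EG] [IsManifold 𝓘(ℝ, EM) ∞ M]
    (hconn : conn.IsFlat (EM := EM) π) (hπ : IsPrincipalBundle EM EG EP G π) (p : P) :
    ∃ W τ, π p ∈ W ∧ conn.IsHorizontalSection (EM := EM) π W τ ∧ τ (π p) = p := by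
  obtain ⟨W, τ, hx, hτ⟩ := hconn.exists_isHorizontalSection hπ (π p)
  exact ⟨W, _, hx, hτ.smul hπ (fibreDiv (τ (π p)) p), hπ.smul_fibreDiv (hτ.section_eq _ hx)⟩

/-- Horizontal sections are continuous into `P`, so the leaf topology is finer; lifts to the
covering are thus paths in `P`. -/
theorem continuous_ofLeaf : Continuous (ofLeaf : LeafSpace EM conn π → P) :=
  continuous_def.2 fun _ hU => isOpen_leaf_iff.2 fun _ _ h =>
    h.contMDiffOn.continuousOn.isOpen_inter_preimage h.isOpen hU

end Leaves

/-! ### Subdivisions and extended paths. -/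

section Subdivisions

theorem IsSubdivision.exists_mem_Ioo {n : ℕ} {t : ℕ → ℝ} (h : IsSubdivision n t) {s : ℝ}
    (hs : s ∈ Ioo (0 : ℝ) 1) (hst : s ∉ range t) : ∃ i < n, s ∈ Ioo (t i) (t (i + 1)) := by
  classical
  have hex : ∃ j, s < t j := ⟨n, h.last.symm ▸ hs.2⟩
  obtain ⟨i, hi⟩ : ∃ i, Nat.find hex = i + 1 := Nat.exists_eq_succ_of_ne_zero fun h0 => by
    have := Nat.find_spec hex
    rw [h0, h.zero] at this
    exact this.not_gt hs.1
  have h1 : s < t (i + 1) := hi ▸ Nat.find_spec hex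
  have h2 : t i ≤ s := not_lt.1 (Nat.find_min hex (by omega))
  have h3 : Nat.find hex ≤ n := Nat.find_min' hex (h.last.symm ▸ hs.2)
  exact ⟨i, by omega, h2.lt_of_ne fun h => hst ⟨i, h⟩, h1⟩

/-- Outside the unit interval the extended path is constant, so the end points can be handled like
any break point. -/
theorem IsSubdivision.mem_Ioo_or_eventuallyEq_const {n : ℕ} {t : ℕ → ℝ} (h : IsSubdivision n t)
    {x y : N} (γ : Path x y) {s : ℝ} (hst : s ∉ range t) :
    (∃ i < n, s ∈ Ioo (t i) (t (i + 1))) ∨ ∃ z, γ.extend =ᶠ[𝓝 s] fun _ => z := by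
  have h0 : s ≠ 0 := fun hs => hst ⟨0, h.zero.trans hs.symm⟩
  have h1 : s ≠ 1 := fun hs => hst ⟨n, h.last.trans hs.symm⟩
  rcases h0.lt_or_gt with hs | hs
  · refine Or.inr ⟨x, ?_⟩
    filter_upwards [Iio_mem_nhds hs] with r hr using γ.extend_of_le_zero (le_of_lt hr)
  rcases h1.lt_or_gt with hs' | hs'
  · exact Or.inl (h.exists_mem_Ioo ⟨hs, hs'⟩ hst)
  · refine Or.inr ⟨y, ?_⟩
    filter_upwards [Ioi_mem_nhds hs'] with r hr using γ.extend_of_one_le (le_of_lt hr)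

theorem IsC1OnPieces.contMDiffAt {x y : N} {γ : Path x y} {n : ℕ} {t : ℕ → ℝ}
    (h : IsC1OnPieces (E := E) γ n t) {i : ℕ} (hi : i < n) {s : ℝ} (hs : s ∈ Ioo (t i) (t (i + 1))) :
    ContMDiffAt 𝓘(ℝ, ℝ) 𝓘(ℝ, E) 1 γ.extend s :=
  (h i hi).contMDiffAt (Icc_mem_nhds hs.1 hs.2)

end Subdivisions

/-! ### Horizontal lifts are the lifts to the leaf space. -/

section Lifts

variable [IsManifold 𝓘(ℝ, EP) ∞ P] [MulAction Gᵐᵒᵖ P] [LieGroup 𝓘(ℝ, EG) ∞ G]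
  {π : P → M} {conn : ConnectionForm EG EP G P}

theorem ConnectionForm.IsHorizontalLift.exists_countable {x y : M} {c : Path x y} {p q : P}
    {γ : Path p q} (h : conn.IsHorizontalLift π c γ) : ∃ T : Set ℝ, T.Countable ∧
      ∀ s ∉ T, ContMDiffAt 𝓘(ℝ, ℝ) 𝓘(ℝ, EP) 1 γ.extend s ∧ conn.along γ.extend s (1 : ℝ) = 0 := by
  obtain ⟨-, n, t, ht, hC, hv⟩ := h
  refine ⟨range t, countable_range t, fun s hs => ?_⟩
  rcases ht.mem_Ioo_or_eventuallyEq_const γ hs with ⟨i, hi, hs⟩ | ⟨z, hz⟩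
  · exact ⟨hC.contMDiffAt hi hs, hv i hi s hs⟩
  · refine ⟨contMDiffAt_const.congr_of_eventuallyEq hz, ?_⟩
    rw [conn.along_congr hz, along, tderiv_const, map_zero]

theorem ConnectionForm.IsHorizontalLift.extend_eq {x y : M} {c : Path x y} {p q : P}
    {γ : Path p q} (h : conn.IsHorizontalLift π c γ) (s : ℝ) : π (γ.extend s) = c.extend s :=
  h.1 (projIcc 0 1 zero_le_one s)

/-- Horizontal lifts are continuous for the leaf topology. -/
theorem ConnectionForm.IsHorizontalLift.continuous_leaf [FiniteDimensional ℝ EM]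
    [FiniteDimensional ℝ EG] [T2Space G] [IsManifold 𝓘(ℝ, EM) ∞ M]
    (hconn : conn.IsFlat (EM := EM) π) (hπ : IsPrincipalBundle EM EG EP G π) {x y : M}
    {c : Path x y} {p q : P} {γ : Path p q} (h : conn.IsHorizontalLift π c γ) :
    Continuous (fun s => toLeaf EM π conn (γ s)) := by
  obtain ⟨T, hT, hd⟩ := h.exists_countable
  suffices hc : Continuous (fun s : ℝ => toLeaf EM π conn (γ.extend s)) by
    refine (hc.comp (continuous_subtype_val (p := (· ∈ unitInterval)))).congr fun s => ?_
    exact congrArg (toLeaf EM π conn) (γ.extend_extends' s)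
  refine continuous_iff_continuousAt.2 fun s₀ => ?_
  -- Near `s₀` the lift runs on a single sheet `τ · g`, even across a break point, and the sheet is
  -- continuous in the leaf topology.
  obtain ⟨W, τ, hW, hτ⟩ := hconn.exists_isHorizontalSection hπ (c.extend s₀)
  obtain ⟨ε, hε, hball⟩ := Metric.isOpen_iff.1 (hτ.isOpen.preimage c.continuous_extend) s₀ hW
  set a := s₀ - ε / 2 with ha
  set b := s₀ + ε / 2 with hb
  have hab : ∀ s ∈ Icc a b, c.extend s ∈ W := fun s hs => hball <| by
    rw [Metric.mem_ball, Real.dist_eq, abs_lt]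
    constructor <;> linarith [hs.1, hs.2]
  have haW : c.extend a ∈ W := hab a ⟨le_rfl, by linarith⟩
  have hg := hπ.smul_fibreDiv (p := τ (c.extend a)) (q := γ.extend a)
    ((hτ.section_eq _ haW).trans (h.extend_eq a).symm)
  set g : G := fibreDiv (τ (c.extend a)) (γ.extend a) with hg'
  have key : ∀ s ∈ Icc a b, γ.extend s = τ (c.extend s) <• g := fun s hs => by
    rw [← h.extend_eq s]
    refine hτ.eq_smul_of_horizontal hπ hT γ.continuous_extend.continuousOn
      (fun s hs => (h.extend_eq s).symm ▸ hab s hs) (fun s hs => hd s hs.2) ?_ hs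
    rw [h.extend_eq a, hg]
  have h1 : ContinuousAt (fun s : ℝ => toLeaf EM π conn (τ (c.extend s) <• g)) s₀ :=
    ContinuousAt.comp (g := fun x => toLeaf EM π conn (τ x <• g)) (f := c.extend)
      ((hτ.smul hπ g).continuousOn_leaf.continuousAt (hτ.isOpen.mem_nhds hW))
      c.continuous_extend.continuousAt
  refine h1.congr ?_
  filter_upwards [Icc_mem_nhds (show a < s₀ by linarith) (show s₀ < b by linarith)] with s hs
  rw [key s hs]

/-- Lifts which are continuous for the leaf topology are horizontal. -/
theorem ConnectionForm.IsFlat.isHorizontalLift [FiniteDimensional ℝ EM]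
    [FiniteDimensional ℝ EG] [T2Space G] [IsManifold 𝓘(ℝ, EM) ∞ M]
    (hconn : conn.IsFlat (EM := EM) π) (hπ : IsPrincipalBundle EM EG EP G π) {x y : M}
    {c : Path x y} (hc : IsPiecewiseC1 (E := EM) c) {p q : P} {γ : Path p q}
    (hγ : Continuous (fun s => toLeaf EM π conn (γ s))) (h : ∀ s, π (γ s) = c s) :
    conn.IsHorizontalLift π c γ := by
  obtain ⟨n, t, ht, hC⟩ := hc
  have hext : ∀ s, π (γ.extend s) = c.extend s := fun s => h (projIcc 0 1 zero_le_one s)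
  -- The sheet through `γ.extend s₀` is open in the leaf topology, so a leaf-continuous lift stays
  -- on it for a while; there it is `τ ∘ c`, which inherits regularity from `c` and horizontality
  -- from `τ`.
  have hloc : ∀ s₀ : ℝ, ∃ W τ, c.extend s₀ ∈ W ∧ conn.IsHorizontalSection (EM := EM) π W τ ∧
      γ.extend =ᶠ[𝓝 s₀] fun s => τ (c.extend s) := fun s₀ => by
    obtain ⟨W, τ, hW, hτ, hp⟩ := hconn.exists_isHorizontalSection_through hπ (γ.extend s₀)
    refine ⟨W, τ, hext s₀ ▸ hW, hτ, ?_⟩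
    have h1 : Continuous (fun s : ℝ => toLeaf EM π conn (γ.extend s)) :=
      hγ.comp continuous_projIcc
    filter_upwards [h1.continuousAt.preimage_mem_nhds
      ((hτ.isOpen_image hπ).mem_nhds ⟨_, hW, congrArg _ hp⟩)] with s hs
    obtain ⟨z, hz, hzs⟩ := hs
    have hzs' : τ z = γ.extend s := hzs
    rw [← hext s, ← hzs', hτ.section_eq z hz]
  refine ⟨h, n, t, ht, fun i hi s hs => ?_, fun i hi s hs => ?_⟩
  · obtain ⟨W, τ, hW, hτ, he⟩ := hloc s
    have h2 := (hτ.contMDiffOn.contMDiffAt (hτ.isOpen.mem_nhds hW)).comp_contMDiffWithinAt s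
      (hC i hi s hs)
    exact h2.congr_of_eventuallyEq (he.filter_mono nhdsWithin_le_nhds) he.self_of_nhds
  · obtain ⟨W, τ, hW, hτ, he⟩ := hloc s
    have h3 : conn.along γ.extend s (1 : ℝ) = 0 := by
      rw [conn.along_congr he, conn.along_comp (f := τ) (h := c.extend) (hτ.mdifferentiableAt hW)
        ((hC.contMDiffAt hi hs).mdifferentiableAt (by simp)), hτ.along_eq_zero _ hW]
    exact h3

end Lifts

/-! ### Holonomy and path-ordered exponentials. -/

section Holonomy

variable [IsManifold 𝓘(ℝ, EP) ∞ P] [MulAction Gᵐᵒᵖ P] [LieGroup 𝓘(ℝ, EG) ∞ G]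
  {π : P → M} {conn : ConnectionForm EG EP G P}

/-- Homotopic loops have the same, unique, holonomy with respect to a flat connection. -/
theorem ConnectionForm.IsFlat.exists_isHolonomy_iff [FiniteDimensional ℝ EM]
    [FiniteDimensional ℝ EG] [T2Space G] [IsManifold 𝓘(ℝ, EM) ∞ M]
    (hconn : conn.IsFlat (EM := EM) π) (hπ : IsPrincipalBundle EM EG EP G π) {x₀ : M} {p₀ : P}
    (hp₀ : π p₀ = x₀) (c₀ : Path x₀ x₀) : ∃ u : G, ∀ c : Path x₀ x₀, c.Homotopic c₀ →
      IsPiecewiseC1 (E := EM) c → ∀ g : G, conn.IsHolonomy π c p₀ g ↔ g = u := by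
  have cov := hconn.isCoveringMap hπ
  have h0 : ∀ c : Path x₀ x₀, (c : C(unitInterval, M)) 0 =
      leafProj (EM := EM) conn π (toLeaf EM π conn p₀) := fun c => c.source.trans hp₀.symm
  -- The lift to the covering from `p₀`; its end point is the same for all loops homotopic to `c₀`,
  -- and `u` is read off from it.
  set L : Path x₀ x₀ → C(unitInterval, LeafSpace EM conn π) := fun c =>
    cov.liftPath c (toLeaf EM π conn p₀) (h0 c) with hL
  have hLc : ∀ c s, π (ofLeaf (L c s)) = c s := fun c s =>
    congrFun (cov.liftPath_lifts c (toLeaf EM π conn p₀) (h0 c)) s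
  have hL0 : ∀ c, L c 0 = toLeaf EM π conn p₀ := fun c => cov.liftPath_zero _ _ (h0 c)
  have hu : p₀ <• (fibreDiv p₀ (ofLeaf (L c₀ 1)) : G) = ofLeaf (L c₀ 1) :=
    hπ.smul_fibreDiv (hp₀.trans ((hLc c₀ 1).trans c₀.target).symm)
  refine ⟨fibreDiv p₀ (ofLeaf (L c₀ 1)), fun c hc hC g => ?_⟩
  have h1 : L c 1 = L c₀ 1 := cov.liftPath_apply_one_eq_of_homotopicRel hc _ (h0 c) (h0 c₀)
  constructor
  · rintro ⟨γ, hγ⟩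
    have h2 : (fun s => toLeaf EM π conn (γ s)) = L c := (cov.eq_liftPath_iff (h0 c)).2
      ⟨hγ.continuous_leaf hconn hπ, funext hγ.1, congrArg (toLeaf EM π conn) γ.source⟩
    have h3 : γ 1 = ofLeaf (L c 1) := congrFun h2 1
    exact (hπ.fibreDiv_eq (γ.target.symm.trans (h3.trans (congrArg ofLeaf h1)))).symm
  · rintro rfl
    refine ⟨⟨⟨fun s => ofLeaf (L c s), continuous_ofLeaf.comp (L c).continuous⟩,
      congrArg ofLeaf (hL0 c), ((congrArg ofLeaf h1).trans hu.symm)⟩, ?_⟩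
    exact hconn.isHorizontalLift hπ hC (L c).continuous (hLc c)

/-- In a local gauge over an open set which contains a loop, the horizontal lifts of the loop
correspond to the path-ordered exponentials of the gauge potential. -/
theorem ConnectionForm.isPathOrderedExp_iff_isHolonomy (hπ : IsPrincipalBundle EM EG EP G π)
    {x₀ : M} {p₀ : P} {c : Path x₀ x₀} {W : Set M} {σ : M → P} (hσ : IsLocalGauge EM EP π W σ)
    (hcW : range c ⊆ W) (hσ₀ : σ x₀ = p₀) (g : G) :
    IsPathOrderedExp (conn.gaugePotential (EM := EM) σ) c g ↔ conn.IsHolonomy π c p₀ g := by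
  have hW : ∀ s, c.extend s ∈ W := fun s => hcW ⟨projIcc 0 1 zero_le_one s, rfl⟩
  have hW' : ∀ s, c s ∈ W := fun s => hcW ⟨s, rfl⟩
  have hσc : ∀ s, ContMDiffAt 𝓘(ℝ, EM) 𝓘(ℝ, EP) 1 σ (c.extend s) := fun s =>
    (hσ.smooth.contMDiffAt (hσ.isOpen.mem_nhds (hW s))).of_le (by simp)
  have hcont : Continuous (fun s => σ (c s)) := hσ.smooth.continuousOn.comp_continuous
    c.continuous hW'
  have hA : ∀ {s : ℝ} (k : ℝ → G), MDifferentiableAt 𝓘(ℝ, ℝ) 𝓘(ℝ, EM) c.extend s →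
      MDifferentiableAt 𝓘(ℝ, ℝ) 𝓘(ℝ, EG) k s →
      (conn.along (fun s => σ (c.extend s) <• k s) s (1 : ℝ) = 0 ↔
        (tderiv k s (1 : ℝ) : EG) = -rightDeriv EG (k s)
          (conn.along σ (c.extend s) (tderiv c.extend s (1 : ℝ) : EM))) := fun {s} k hc hk => by
    have h1 := (hσc s).mdifferentiableAt (by simp)
    rw [conn.along_smul_eq_zero_iff (f := fun s => σ (c.extend s)) hπ (h1.comp (g := σ) s hc) hk,
      conn.along_comp (f := σ) (h := c.extend) h1 hc]
  constructor
  · rintro ⟨U, n, t, ht, hcC, hUC, hU⟩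
    refine ⟨⟨⟨fun s => σ (c s) <• U s, hπ.smooth_act.continuous.comp
      (hcont.prodMk U.continuous)⟩, ?_, ?_⟩, fun s => ?_, n, t, ht, ?_, ?_⟩
    · change σ (c 0) <• U 0 = p₀
      rw [c.source, U.source, hσ₀]; simp
    · change σ (c 1) <• U 1 = p₀ <• g
      rw [c.target, U.target, hσ₀]
    · change π (σ (c s) <• U s) = c s
      rw [hπ.proj_act, hσ.section_eq _ (hW' s)]
    · intro i hi s hs
      exact (hπ.smooth_act.of_le (by simp)).contMDiffAt.comp_contMDiffWithinAt s
        (((hσc s).comp_contMDiffWithinAt s (hcC i hi s hs)).prodMk (hUC i hi s hs))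
    · intro i hi s hs
      exact (hA U.extend ((hcC.contMDiffAt hi hs).mdifferentiableAt (by simp))
        ((hUC.contMDiffAt hi hs).mdifferentiableAt (by simp))).2 (hU i hi s hs)
  · rintro ⟨γ, hγ⟩
    have hfib : ∀ s, π (σ (c s)) = π (γ s) := fun s =>
      (hσ.section_eq _ (hW' s)).trans (hγ.1 s).symm
    have hfib' : ∀ s, π (σ (c.extend s)) = π (γ.extend s) := fun s =>
      (hσ.section_eq _ (hW s)).trans (hγ.extend_eq s).symm
    have hk : Continuous (fun s : ℝ => (fibreDiv (σ (c.extend s)) (γ.extend s) : G)) :=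
      continuous_iff_continuousAt.2 fun s => continuousWithinAt_univ _ _ |>.1
        (hπ.contMDiffWithinAt_fibreDiv (E := ℝ) (n := 0) (by simp) (mem_univ s)
          (contMDiffWithinAt_univ.2 ((contMDiff_zero_iff.2
            (hcont.comp continuous_projIcc)).contMDiffAt))
          (contMDiffWithinAt_univ.2 ((contMDiff_zero_iff.2 γ.continuous_extend).contMDiffAt))
          (fun s _ => hfib' s)).continuousWithinAt
    obtain ⟨-, n, t, ht, hC, hv⟩ := id hγ
    have hce : (c.extend : ℝ → M) = fun s => π (γ.extend s) := funext fun s => (hγ.extend_eq s).symm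
    -- The loop is `C¹` on the pieces of its lift, being its projection, so one subdivision serves
    -- for `c`, `γ` and `U`.
    have hcC : IsC1OnPieces (E := EM) c n t := fun i hi => by
      rw [hce]
      exact (hπ.smooth_proj.of_le (by simp)).comp_contMDiffOn (hC i hi)
    let U : Path (1 : G) g :=
      { toFun := fun s => fibreDiv (σ (c s)) (γ s)
        continuous_toFun := (hk.comp continuous_subtype_val).congr fun s => by
          simp only [Function.comp_apply, Path.extend_extends']
        source' := hπ.fibreDiv_eq (by rw [c.source, γ.source, hσ₀]; simp)
        target' := hπ.fibreDiv_eq (by rw [c.target, γ.target, hσ₀]) }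
    have hUC : IsC1OnPieces (E := EG) U n t := fun i hi s hs =>
      hπ.contMDiffWithinAt_fibreDiv (by simp) hs
        ((hσc s).comp_contMDiffWithinAt s (hcC i hi s hs)) (hC i hi s hs) (fun s _ => hfib' s)
    refine ⟨U, n, t, ht, hcC, hUC, fun i hi s hs => ?_⟩
    refine (hA U.extend ((hcC.contMDiffAt hi hs).mdifferentiableAt (by simp))
        ((hUC.contMDiffAt hi hs).mdifferentiableAt (by simp))).1 ?_
    have he : (fun s => σ (c.extend s) <• U.extend s) = γ.extend := funext fun s =>
      hπ.smul_fibreDiv (hfib' s)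
    rw [he]
    exact hv i hi s hs

end Holonomy

end FlatBundle

end

theorem theorem1
    {EM EG EP : Type*}
    [NormedAddCommGroup EM] [NormedSpace ℝ EM] [FiniteDimensional ℝ EM]
    [NormedAddCommGroup EG] [NormedSpace ℝ EG] [FiniteDimensional ℝ EG]
    [NormedAddCommGroup EP] [NormedSpace ℝ EP] [FiniteDimensional ℝ EP]
    {M : Type*} [TopologicalSpace M] [T2Space M] [ChartedSpace EM M] [IsManifold 𝓘(ℝ, EM) ∞ M]
    {G : Type*} [TopologicalSpace G] [T2Space G] [ChartedSpace EG G] [Group G]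
    [LieGroup 𝓘(ℝ, EG) ∞ G]
    {P : Type*} [TopologicalSpace P] [T2Space P] [ChartedSpace EP P] [IsManifold 𝓘(ℝ, EP) ∞ P]
    [MulAction Gᵐᵒᵖ P]
    (π : P → M) (hπ : FlatBundle.IsPrincipalBundle EM EG EP G π)
    (conn : FlatBundle.ConnectionForm EG EP G P) (hconn : conn.IsFlat (EM := EM) π)
    (x₀ : M) (p₀ : P) (hp₀ : π p₀ = x₀)
    (c₁ c₂ : Path x₀ x₀)
    (hc₁ : FlatBundle.IsPiecewiseC1 (E := EM) c₁)
    (hc₂ : FlatBundle.IsPiecewiseC1 (E := EM) c₂)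
    (hc : c₁.Homotopic c₂) :
    -- one element `u` of `G` is the holonomy of both loops
    ∃ u : G, ∀ c ∈ ({c₁, c₂} : Set (Path x₀ x₀)),
      (∀ g : G, conn.IsHolonomy π c p₀ g ↔ g = u) ∧
      -- and it is the path-ordered exponential of the potential in each gauge that covers the loop
      ∀ (W : Set M) (σ : M → P), FlatBundle.IsLocalGauge EM EP π W σ → range c ⊆ W → σ x₀ = p₀ →
        ∀ g : G, FlatBundle.IsPathOrderedExp (conn.gaugePotential (EM := EM) σ) c g ↔ g = u := by

  -- Here `u` is fixed by the homotopy class of `c₂` alone, so it serves both loops.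
  obtain ⟨u, hu⟩ := hconn.exists_isHolonomy_iff hπ hp₀ c₂
  refine ⟨u, fun c hcc => ?_⟩
  have h1 : c.Homotopic c₂ ∧ FlatBundle.IsPiecewiseC1 (E := EM) c := by
    rcases hcc with rfl | rfl
    · exact ⟨hc, hc₁⟩
    · exact ⟨Path.Homotopic.refl _, hc₂⟩
  have h2 := hu c h1.1 h1.2
  exact ⟨h2, fun W σ hσ hcW hσ₀ g =>
    (conn.isPathOrderedExp_iff_isHolonomy hπ hσ hcW hσ₀ g).trans (h2 g)⟩
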